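/- Take a circle of perimeter $1$, a line segment of length $\frac12$ and a rectangle of size $0.1727\times 0.3273$ in the Euclidean plane, each placed anywhere by a rotation and a translation. The convex hull of the three figures always has area at least $0.1$. Equivalently, every convex set $S$ in the plane such that each of these three figures can be moved into $S$ by a rotation and a translation has area at least $0.1$. -/

import Mathlib

open MeasureTheory

noncomputable section

namespace ConvexCover

/-- The Euclidean plane. Its `volume` is the area (two-dimensional Lebesgue measure). -/
abbrev Plane : Type := EuclideanSpace ℝ (Fin 2)

/-- The orientation-preserving motion of the plane that rotates by the angle `θ` about the origin
and then translates by the vector `t`. -/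
def motion (θ : ℝ) (t : Plane) (p : Plane) : Plane :=
  !₂[Real.cos θ * p 0 - Real.sin θ * p 1 + t 0, Real.sin θ * p 0 + Real.cos θ * p 1 + t 1]

/-- `K'` is a copy of the figure `K` under a rotation and a translation. -/
def IsCopy (K K' : Set Plane) : Prop :=
  ∃ (θ : ℝ) (t : Plane), K' = motion θ t '' K

/-- `S` is a convex cover for a family `𝓕` of figures: `S` is convex, and every figure of the
family can be rotated and translated into `S`. -/
def IsConvexCover (𝓕 : Set (Set Plane)) (S : Set Plane) : Prop :=
  Convex ℝ S ∧ ∀ K ∈ 𝓕, ∃ K', IsCopy K K' ∧ K' ⊆ S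

/-- The circle of perimeter `ℓ` centred at the origin: its radius is `ℓ / (2π)`. -/
def circleOfPerimeter (ℓ : ℝ) : Set Plane :=
  Metric.sphere 0 (ℓ / (2 * Real.pi))

/-- The line segment of length `ℓ` on the first coordinate axis, centred at the origin. -/
def segmentOfLength (ℓ : ℝ) : Set Plane :=
  segment ℝ (!₂[-(ℓ / 2), 0] : Plane) (!₂[ℓ / 2, 0] : Plane)

/-- The (solid) rectangle with sides `a` and `b` parallel to the coordinate axes, centred at the
origin. -/
def rectangle (a b : ℝ) : Set Plane :=
  {p | |p 0| ≤ a / 2 ∧ |p 1| ≤ b / 2}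

end ConvexCover

end

set_option maxRecDepth 100000

open MeasureTheory

noncomputable section

namespace ConvexCover

/-! Both claims concern a convex set `S` containing copies of the three figures, and
`le_volume_of_copies` treats them together. Lengths are multiplied by 102400000. Moving the centre
of the circle to the origin and turning the segment horizontal leaves five parameters: the midpoint
`X` of the segment, the centre `Y` of the rectangle and its direction `(c, s)`. Convexity fills the
circle, so a disc of radius 16297460, slightly below the true radius, is available. Symmetries
reduce to `c, s, X.1 ≥ 0` (`Contains.le_volume`). A point of the set at scaled distance 0.47 from
the origin already forces the area (`le_volume_of_far_point`), which confines `X` and `Y` to a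
compact box.

On this box the area is bounded below by branch and bound. If vertices in the set form a closed
chain winding once counterclockwise around the origin, the triangles joining the origin to its edges
lie in disjoint cones and, by convexity, in the set. Half the sum of the cross products is therefore
a lower bound for the area, even when the chain is not convex (`pathSum_closed_le`,
`cross_le_sector`). The vertices used are the ends of the segment, the corners of the rectangle and
a 72-gon in the disc.

The direction is parametrized by `t`, the tangent of its half angle, and `[0, 1]` is cut into 23
cells. In each cell the box for `(X, Y)` is bisected until an expansion of the cross sum about the
midpoint, with rigorous error terms, gives twice the required area (`bound_sums_le`,
`le_bound_of_large`). An unverified gift wrapping proposes the chains; only the turning of the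
edges, the winding and the area are checked. The kernel runs the search in natural number
arithmetic, and `le_volume_of_search` proves it sound. -/

/-! ### Area of a convex set inside cones at the origin. -/

/-- The cross product of two vectors of the plane. -/
def cross (u v : ℝ × ℝ) : ℝ := u.1 * v.2 - u.2 * v.1

/-- The open cone swept from the direction `u` to the direction `w`. -/
def cone (u w : ℝ × ℝ) : Set (ℝ × ℝ) := {p | 0 < cross u p ∧ 0 < cross p w}

/-- Twice the area of the part of `K` inside the cone from `u` to `w`. -/
def sector (K : Set (ℝ × ℝ)) (u w : ℝ × ℝ) : ℝ := 2 * (volume.restrict K).real (cone u w)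

theorem measurableSet_cone (u w : ℝ × ℝ) : MeasurableSet (cone u w) := by
  have h1 : IsOpen {p : ℝ × ℝ | 0 < cross u p} := by
    unfold cross; exact isOpen_lt (by fun_prop) (by fun_prop)
  have h2 : IsOpen {p : ℝ × ℝ | 0 < cross p w} := by
    unfold cross; exact isOpen_lt (by fun_prop) (by fun_prop)
  exact (h1.inter h2).measurableSet

theorem cone_disjoint (u v w : ℝ × ℝ) : Disjoint (cone u v) (cone v w) := by
  rw [Set.disjoint_left]
  rintro p ⟨_, h⟩ ⟨h', _⟩
  simp only [cross] at h h'
  linarith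

/-- The three-term relation between cross products, `key`, writes each missing sign as a sum of a
positive and a nonnegative product. The hypothesis on `cross u w` keeps the union of the two cones
within half a turn. -/
theorem cone_subset {u v w : ℝ × ℝ} (h1 : 0 < cross u v) (h2 : 0 < cross v w)
    (h3 : 0 ≤ cross u w) : cone u v ∪ cone v w ⊆ cone u w := by
  have key : ∀ p, cross u v * cross p w = cross u p * cross v w + cross u w * cross p v := by
    intro p; simp only [cross]; ring
  rintro p (⟨ha, hb⟩ | ⟨ha, hb⟩)
  · refine ⟨ha, ?_⟩
    have := key p
    have h4 : 0 < cross u v * cross p w := by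
      rw [this]; have := mul_pos ha h2; have := mul_nonneg h3 hb.le; linarith
    exact pos_of_mul_pos_right h4 h1.le
  · refine ⟨?_, hb⟩
    have := key p
    have hc : cross p v = - cross v p := by simp only [cross]; ring
    have h4 : 0 < cross u p * cross v w := by
      have e : cross u p * cross v w = cross u v * cross p w + cross u w * cross v p := by
        rw [this, hc]; ring
      rw [e]; have := mul_pos h1 hb; have := mul_nonneg h3 ha.le; linarith
    exact pos_of_mul_pos_left h4 h2.le

section
variable {K : Set (ℝ × ℝ)}

theorem sector_add_le (hK : volume K ≠ ⊤) {u v w : ℝ × ℝ} (h1 : 0 < cross u v)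
    (h2 : 0 < cross v w) (h3 : 0 ≤ cross u w) :
    sector K u v + sector K v w ≤ sector K u w := by
  have : IsFiniteMeasure (volume.restrict K) := ⟨by simpa using hK.lt_top⟩
  unfold sector
  rw [← mul_add, ← measureReal_union (cone_disjoint u v w) (measurableSet_cone v w)]
  have := measureReal_mono (μ := volume.restrict K) (cone_subset h1 h2 h3)
  linarith

/-- Consecutive open cones are disjoint whatever the signs of the cross products, so no hypothesis
on the three directions is needed. -/
theorem sector_add_add_le (hK : volume K ≠ ⊤) (u v w : ℝ × ℝ) :
    sector K u v + sector K v w + sector K w u ≤ 2 * volume.real K := by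
  have : IsFiniteMeasure (volume.restrict K) := ⟨by simpa using hK.lt_top⟩
  unfold sector
  rw [← mul_add, ← measureReal_union (cone_disjoint u v w) (measurableSet_cone v w), ← mul_add,
    ← measureReal_union _ (measurableSet_cone w u)]
  · have := measureReal_mono (μ := volume.restrict K)
      (Set.subset_univ ((cone u v ∪ cone v w) ∪ cone w u))
    have e : (volume.restrict K).real Set.univ = volume.real K := by
      simp [measureReal_restrict_apply]
    linarith
  · rw [Set.disjoint_union_left]
    exact ⟨(cone_disjoint w u v).symm, cone_disjoint v w u⟩

theorem volume_real_standard_triangle :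
    volume.real {p : ℝ × ℝ | 0 < p.1 ∧ 0 < p.2 ∧ p.1 + p.2 < 1} = 1 / 2 := by
  have e : {p : ℝ × ℝ | 0 < p.1 ∧ 0 < p.2 ∧ p.1 + p.2 < 1}
      = regionBetween (fun _ => (0 : ℝ)) (fun x => 1 - x) (Set.Ioc 0 1) := by
    ext ⟨x, y⟩
    simp only [regionBetween, Set.mem_ofPred_eq, Set.mem_Ioc, Set.mem_Ioo]
    constructor
    · rintro ⟨a, b, c⟩; exact ⟨⟨a, by linarith⟩, b, by linarith⟩
    · rintro ⟨⟨a, _⟩, b, c⟩; exact ⟨a, b, by linarith⟩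
  have hi : IntervalIntegrable (fun x : ℝ => 1 - x) volume 0 1 :=
    (continuous_const.sub continuous_id).intervalIntegrable _ _
  rw [e, measureReal_def, Measure.volume_eq_prod, volume_regionBetween_eq_integral]
  · rw [ENNReal.toReal_ofReal]
    · simp only [Pi.sub_apply, sub_zero]
      rw [← intervalIntegral.integral_of_le zero_le_one]
      rw [intervalIntegral.integral_sub (by simp) (by simp)]
      simp; norm_num
    · apply setIntegral_nonneg measurableSet_Ioc
      intro x hx; simpa using hx.2
  · exact integrableOn_zero
  · exact (intervalIntegrable_iff_integrableOn_Ioc_of_le zero_le_one).1 hi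
  · exact measurableSet_Ioc
  · intro x hx; simpa using hx.2

/-- The linear map taking the standard basis to `u`, `w`. -/
def frame (u w : ℝ × ℝ) : ℝ × ℝ →ₗ[ℝ] ℝ × ℝ :=
  Matrix.toLin (Module.Basis.finTwoProd ℝ) (Module.Basis.finTwoProd ℝ) !![u.1, w.1; u.2, w.2]

theorem frame_apply (u w p : ℝ × ℝ) :
    frame u w p = (u.1 * p.1 + w.1 * p.2, u.2 * p.1 + w.2 * p.2) := by
  unfold frame; rw [Matrix.toLin_finTwoProd_apply]

theorem det_frame (u w : ℝ × ℝ) : LinearMap.det (frame u w) = cross u w := by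
  unfold frame; rw [LinearMap.det_toLin, Matrix.det_fin_two_of]; simp only [cross]; ring

/-- The open triangle with vertices `0`, `u`, `w` is the image of the standard triangle under `frame
u w`. It lies in the cone, and in `K` by convexity. -/
theorem cross_le_sector (hc : Convex ℝ K) (hK : volume K ≠ ⊤) {u w : ℝ × ℝ} (h0 : (0 : ℝ × ℝ) ∈ K)
    (hu : u ∈ K) (hw : w ∈ K) : cross u w ≤ sector K u w := by
  rcases le_or_gt (cross u w) 0 with h | h
  · exact h.trans (mul_nonneg zero_le_two measureReal_nonneg)
  set T := {p : ℝ × ℝ | 0 < p.1 ∧ 0 < p.2 ∧ p.1 + p.2 < 1}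
  have hsub : frame u w '' T ⊆ cone u w ∩ K := by
    rintro _ ⟨p, ⟨h1, h2, h3⟩, rfl⟩
    rw [frame_apply]
    refine ⟨⟨?_, ?_⟩, ?_⟩
    · have : cross u (u.1 * p.1 + w.1 * p.2, u.2 * p.1 + w.2 * p.2) = p.2 * cross u w := by
        simp only [cross]; ring
      rw [this]; positivity
    · have : cross (u.1 * p.1 + w.1 * p.2, u.2 * p.1 + w.2 * p.2) w = p.1 * cross u w := by
        simp only [cross]; ring
      rw [this]; positivity
    · have := hc.sum_mem (t := Finset.univ) (w := ![p.1, p.2, 1 - p.1 - p.2]) (z := ![u, w, 0])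
        (by intro i _; fin_cases i <;> simp <;> linarith) (by simp [Fin.sum_univ_three])
        (by intro i _; fin_cases i <;> simp [*])
      convert this using 1
      simp only [Fin.sum_univ_three]
      ext <;> simp [mul_comm]
  have himg : volume (frame u w '' T) = ENNReal.ofReal |cross u w| * volume T := by
    rw [Measure.addHaar_image_linearMap, det_frame]
  have hle : volume (frame u w '' T) ≤ (volume.restrict K) (cone u w) := by
    rw [Measure.restrict_apply (measurableSet_cone u w)]
    exact measure_mono hsub
  have : IsFiniteMeasure (volume.restrict K) := ⟨by simpa using hK.lt_top⟩
  have h5 : (volume (frame u w '' T)).toReal ≤ (volume.restrict K).real (cone u w) :=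
    ENNReal.toReal_mono (measure_ne_top _ _) hle
  rw [himg, ENNReal.toReal_mul, ENNReal.toReal_ofReal (abs_nonneg _), abs_of_pos h] at h5
  have h6 : (volume T).toReal = 1 / 2 := volume_real_standard_triangle
  rw [h6] at h5
  unfold sector
  linarith

end

/-! ### Closed chains winding once around the origin. -/

/-- `s + ω` summed over the consecutive pairs of `v :: l`. -/
def pathSum {α : Type} (ω : α → α → ℝ) : α → List α → ℝ
  | _, [] => 0
  | v, w :: l => ω v w + pathSum ω w l

theorem pathSum_concat {α : Type} (ω : α → α → ℝ) (v : α) (l : List α) (a b : α) :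
    pathSum ω v (l ++ [a, b]) = pathSum ω v (l ++ [a]) + ω a b := by
  induction l generalizing v with
  | nil => simp [pathSum]
  | cons w l ih => simp only [List.cons_append, pathSum, ih]; ring

section chain
variable {α : Type} {K : Set (ℝ × ℝ)} {z : α → ℝ × ℝ} {ω : α → α → ℝ}

/-- The weight of an edge is a lower bound of the area it sweeps counterclockwise. -/
def Edge (K : Set (ℝ × ℝ)) (z : α → ℝ × ℝ) (ω : α → α → ℝ) (v w : α) : Prop :=
  0 < cross (z v) (z w) ∧ ω v w ≤ sector K (z v) (z w)

/-- All vertices lie within the half turn before `A`, so the sectors can be merged from the end of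
the path without ever exceeding half a turn. -/
theorem pathSum_le_of_after (hK : volume K ≠ ⊤) (A : α) (l : List α) :
    ∀ v : α, 0 < cross (z v) (z A) → List.IsChain (Edge K z ω) (v :: (l ++ [A])) →
      (∀ w ∈ l, 0 < cross (z w) (z A)) → pathSum ω v (l ++ [A]) ≤ sector K (z v) (z A) := by
  induction l with
  | nil =>
    intro v _ h _
    simp only [List.nil_append, List.isChain_cons_cons, List.isChain_singleton, and_true] at h
    simpa [pathSum] using h.2
  | cons w l ih =>
    intro v hv h hl
    simp only [List.cons_append, List.isChain_cons_cons] at h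
    have hw := hl w (by simp)
    have h1 := ih w hw h.2 (fun x hx => hl x (by simp [hx]))
    have h2 := sector_add_le hK h.1.1 hw hv.le
    simp only [List.cons_append, pathSum]
    linarith [h.1.2]

/-- The signs of `A × v` along `l` are `+ … +`, then at most one unknown sign, then `- … -`. -/
def Turns (z : α → ℝ × ℝ) (A : α) : List α → Prop
  | [] => True
  | w :: l => (0 < cross (z A) (z w) ∧ Turns z A l) ∨ ∀ x ∈ l, 0 < cross (z x) (z A)

theorem cross_swap (u v : ℝ × ℝ) : cross u v = - cross v u := by simp only [cross]; ring

/-- The path is consumed while one sector starting at `A` grows. Once the path passes the half turn,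
the remaining edges merge into a sector ending at `A`, and three disjoint cones are left. -/
theorem pathSum_le_of_turns (hK : volume K ≠ ⊤) (A : α) (l : List α) :
    ∀ v : α, 0 < cross (z A) (z v) → List.IsChain (Edge K z ω) (v :: (l ++ [A])) →
      Turns z A l → sector K (z A) (z v) + pathSum ω v (l ++ [A]) ≤ 2 * volume.real K := by
  induction l with
  | nil =>
    intro v hv h _
    simp only [List.nil_append, List.isChain_cons_cons, List.isChain_singleton, and_true] at h
    have := h.1
    rw [cross_swap] at this
    linarith
  | cons w l ih =>
    intro v hv h hl
    simp only [List.cons_append, List.isChain_cons_cons] at h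
    obtain ⟨⟨h1, h2⟩, h3⟩ := h
    simp only [List.cons_append, pathSum]
    rcases hl with ⟨hw, hl⟩ | hl
    · have := ih w hw h3 hl
      have := sector_add_le hK hv h1 hw.le
      linarith
    -- The sign at `w` is unknown. Beyond the half turn, `w` separates the second and third cones;
    -- otherwise it joins the first cone and the next vertex takes this role.
    rcases lt_or_ge (cross (z A) (z w)) 0 with hw | hw
    · have hw' : 0 < cross (z w) (z A) := by rw [cross_swap]; linarith
      have := pathSum_le_of_after hK A l w hw' h3 hl
      have := sector_add_add_le hK (z A) (z v) (z w)
      linarith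
    · have h4 := sector_add_le hK hv h1 hw
      cases l with
      | nil =>
        simp only [List.nil_append, List.isChain_cons_cons, List.isChain_singleton, and_true] at h3
        have := h3.1
        rw [cross_swap] at this
        linarith
      | cons x l =>
        simp only [List.cons_append, List.isChain_cons_cons] at h3
        obtain ⟨⟨h5, h6⟩, h7⟩ := h3
        have hx := hl x (by simp)
        have := pathSum_le_of_after hK A l x hx h7 (fun y hy => hl y (by simp [hy]))
        have := sector_add_add_le hK (z A) (z w) (z x)
        simp only [List.cons_append, pathSum]
        linarith

/-- The area swept by a closed chain that winds once around the origin. -/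
theorem pathSum_closed_le (hK : volume K ≠ ⊤) (A : α) (l : List α)
    (h : List.IsChain (Edge K z ω) (A :: (l ++ [A]))) (hl : Turns z A l) :
    pathSum ω A (l ++ [A]) ≤ 2 * volume.real K := by
  cases l with
  | nil =>
    simp only [List.nil_append, List.isChain_cons_cons, List.isChain_singleton, and_true] at h
    have := h.1
    simp only [cross] at this
    linarith
  | cons v l =>
    simp only [List.cons_append, List.isChain_cons_cons] at h
    obtain ⟨⟨h1, h2⟩, h3⟩ := h
    simp only [List.cons_append, pathSum]
    rcases hl with ⟨_, hl⟩ | hl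
    · have := pathSum_le_of_turns hK A l v h1 h3 hl
      linarith
    · have : Turns z A l := by
        cases l with
        | nil => trivial
        | cons x l => exact Or.inr (fun y hy => hl y (by simp [hy]))
      have := pathSum_le_of_turns hK A l v h1 h3 this
      linarith

end chain
-- The search, written for evaluation by the kernel.
namespace Search

/-- Evaluate `n` to a numeral before passing it on. The search below is run by kernel reduction, so
it is written with recursors and with the operations on `Nat` that the kernel evaluates natively.
Lengths are multiplied by `102400000`, and `102400000` is added to coordinates. -/
def strict {α : Type} (n : Nat) (k : Nat → α) : α :=
  Nat.rec (motive := fun _ => α) (k 0) (fun m _ => k (Nat.succ m)) n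

def sel {α : Type} (b : Bool) (t f : α) : α := Bool.rec (motive := fun _ => α) f t b

def loop {α : Type} (n : Nat) (z : α) (s : α → α) : α := Nat.rec (motive := fun _ => α) z (fun _ ih => s ih) n

def lrec {β α : Type} (l : List β) (z : α) (s : β → List β → α → α) : α := List.rec (motive := fun _ => α) z s l

def both (a b : Bool) : Bool := Bool.rec (motive := fun _ => Bool) false b a

def dist (a b : Nat) : Nat := Nat.add (Nat.sub a b) (Nat.sub b a)

/-- A vertex at the midpoint of a box: its code, its coordinates, their distances from the origin,
whether it moves with the segment or the rectangle, how far it moves within the box, and its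
position relative to the centre of the rectangle. -/
structure Pt where
  code : Nat
  x : Nat
  y : Nat
  ax : Nat
  ay : Nat
  fp : Nat
  fq : Nat
  rx : Nat
  ry : Nat
  wx : Nat
  wy : Nat

/-- Coordinates of the 72 vertices of a polygon inscribed in the circle, 32 bits each. -/
abbrev gonTable : Nat := 0x604d37f07123bb305ef5138070f66c805da2313070ab4b905c5725507042eaa05b1674c06fbe152059e290706f1dcde058bdd0106e634d1057aa6e306d8ffe2056aa83406ca57cc055c001e06ba591d054ecb2f06a922ff054323220696d6f905391eae068398b40530d156066f8dab052a4b47065adced052599380645aec80522c44d06302c810521d20c061a80000522c44d0604d37f0525993805ef5138052a4b4705da23130530d15605c5725505391eae05b1674c05432322059e2906054ecb2f058bdd01055c001e057aa6e3056aa834056aa834057aa6e3055c001e058bdd01054ecb2f059e29060543232205b1674c05391eae05c572550530d15605da2313052a4b4705ef5138052599380604d37f0522c44d061a80000521d20c06302c810522c44d0645aec805259938065adced052a4b47066f8dab0530d156068398b405391eae0696d6fa0543232206a922ff054ecb2f06ba591d055c001e06ca57cc056aa83406d8ffe2057aa6e306e634d1058bdd0106f1dcde059e290706fbe15205b1674c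07042eaa05c57255070ab4b905da2313070f66c805ef513807123bb30604d37f07132df4061a800007123bb306302c81070f66c80645aec8070ab4b9065adced07042eaa066f8dab06fbe152068398b406f1dcde0696d6fa06e634d106a922ff06d8ffe206ba591d06ca57cc06ca57cc06ba591d06d8ffe206a922ff06e634d10696d6f906f1dcde068398b406fbe152066f8dab07042eaa065adced070ab4b90645aec8070f66c806302c8107123bb3061a800007132df4

def mkPt {α : Type} (code x y fp fq rx ry wx wy : Nat) (f : Pt → α) : α :=
  strict x fun x => strict y fun y => strict (dist x 102400000) fun ax => strict (dist y 102400000) fun ay =>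
    f ⟨code, x, y, ax, ay, fp, fq, rx, ry, wx, wy⟩

def gonPt {α : Type} (k : Nat) (f : Pt → α) : α :=
  strict (Nat.mod k 72) fun k =>
  strict (Nat.mod (Nat.shiftRight gonTable (Nat.mul 64 k)) 18446744073709551616) fun v =>
  strict (Nat.add 6 k) fun c =>
  mkPt c (Nat.mod v 4294967296) (Nat.div v 4294967296) 0 0 0 0 0 0 f

/-- The cross product of the centred points is `crossP v w - crossN v w`: the squares of the offset
cancel, and the negative terms are collected separately to stay in `Nat`. -/
def crossP (v w : Pt) : Nat := Nat.add (Nat.mul v.x w.y) (Nat.mul 102400000 (Nat.add v.y w.x))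
def crossN (v w : Pt) : Nat := Nat.add (Nat.mul v.y w.x) (Nat.mul 102400000 (Nat.add v.x w.y))

/-- How much the cross product of `v` and `w` can vary within the box. -/
def margin (v w : Pt) : Nat :=
  Nat.add (Nat.add (Nat.mul v.rx (Nat.add w.ay w.ry)) (Nat.mul v.ry (Nat.add w.ax w.rx)))
   (Nat.add (Nat.mul w.rx v.ay) (Nat.mul w.ry v.ax))

/-- Throughout the box, `w` lies counterclockwise from `v`. -/
def sure (v w : Pt) : Bool := Nat.ble (Nat.succ (Nat.add (crossN v w) (margin v w))) (crossP v w)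

def tri (o a b : Pt) : Bool :=
  Nat.ble (Nat.succ (Nat.add (Nat.mul o.x a.y) (Nat.add (Nat.mul a.x b.y) (Nat.mul b.x o.y))))
   (Nat.add (Nat.mul o.y a.x) (Nat.add (Nat.mul a.y b.x) (Nat.mul b.y o.x)))

/-- A candidate for a vertex of the convex hull, with the points where the tangents to the circle
end. -/
structure Cand where
  p : Pt
  n : Nat
  k : Nat
  r : Pt
  li : Nat
  ri : Nat

/-- An approximation of the angle of `(x, y)` in the first quadrant, in units of `1 / 73728` turn. -/
def angle (x y : Nat) : Nat :=
  strict (Nat.div (Nat.mul 1024 y) (Nat.add x y)) fun u =>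
  strict (Nat.mul u (Nat.sub 1024 u)) fun p =>
   Nat.mul 18 (Nat.sub (Nat.add u (Nat.div (Nat.mul p u) 1087000)) (Nat.div p 2123))

def addCand {α : Type} (v : Pt) (f : List Cand → α) (rest : List Cand) : α :=
  strict (Nat.add (Nat.mul v.ax v.ax) (Nat.mul v.ay v.ay)) fun n =>
  sel (Nat.ble 267000000000000 n)
   (strict (angle v.ax v.ay) fun j =>
    strict (sel (Nat.ble 102400000 v.x)
      (sel (Nat.ble 102400000 v.y) (Nat.add 74240 j) (Nat.sub 147968 j))
      (sel (Nat.ble 102400000 v.y) (Nat.sub 111104 j) (Nat.add 111104 j))) fun k =>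
    f (List.cons ⟨v, n, k, v, 0, 0⟩ rest)) (f rest)

/-- The angular position of `c` relative to the more distant candidates is certain. -/
def clear (c : Cand) (l : List Cand) : Bool :=
  lrec l true fun d _ ih =>
   sel (Nat.ble d.n c.n) ih
   (sel (Nat.ble (Nat.mod (Nat.add (Nat.sub (Nat.add d.k 147456) c.k) 8192) 73728) 16384)
     (sel (sure c.p d.p) ih (sel (sure d.p c.p) ih false)) ih)

/-- `q` is approximately the squared tangent length, and `s` its square root by Newton steps started
at 18432000. The tangent points lie at the angle `t` on either side of the candidate; 1024 angular
units are one step of the 72-gon. -/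
def tangents {α : Type} (c : Cand) (f : Cand → α) (g : α) : α :=
  strict (Nat.sub c.n 265607202252000) fun q =>
  strict (Nat.add (Nat.div q 36864000) 9216000) fun s =>
  strict (Nat.div (Nat.add s (Nat.div q s)) 2) fun s =>
  strict (Nat.div (Nat.add s (Nat.div q s)) 2) fun s =>
  sel (Nat.ble s (Nat.add c.p.rx c.p.ry)) g (strict (angle 16297460 s) fun t =>
  strict (Nat.mod (Nat.div (Nat.sub c.k t) 1024) 72) fun l =>
  strict (Nat.mod (Nat.div (Nat.add c.k t) 1024) 72) fun r =>
  sel (Nat.beq l r) g (gonPt r fun rp => f ⟨c.p, c.n, c.k, rp, l, r⟩))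

def refine {α : Type} (f : List Cand → α) (all : List Cand) (l : List Cand) : List Cand → α :=
  lrec l f fun c _ ih a => sel (clear c all) (tangents c (fun d => ih (List.cons d a)) (ih a)) (ih a)

def farthest {α : Type} (f : Cand → α) (l : List Cand) : Cand → α :=
  lrec l f fun d _ ih c => sel (Nat.ble c.n d.n) (ih d) (ih c)

def wrapNext {α : Type} (f : Cand → α) (cur : Cand) (l : List Cand) : Cand → Pt → α → α :=
  lrec l (fun b _ g => sel (Nat.beq b.p.code cur.p.code) g (f b)) fun d _ ih b q g => sel (tri cur.p q d.p) (ih d d.p g) (ih b q g)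

def arcNext {α : Type} (f : Cand → α) (i : Nat) (l : List Cand) : Nat → Cand → α :=
  lrec l (fun _ b => f b) fun d _ ih m b =>
    strict (Nat.mod (Nat.sub (Nat.add d.li 72) i) 72) fun e =>
    sel (Nat.ble (Nat.succ e) m) (ih e d)
     (sel (Nat.beq e m) (gonPt d.li fun l => sel (tri l b.p d.p) (ih m d) (ih m b)) (ih m b))

/-- An edge between polygon vertices is accepted only up to 35 steps, just short of half a turn, so
longer arcs receive intermediate vertices after 35 and 70 steps. -/
def arcCodes (i j : Nat) (acc : List Nat) : List Nat :=
  strict (Nat.mod (Nat.sub (Nat.add j 72) i) 72) fun e =>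
   List.cons (Nat.add 6 i) (sel (Nat.beq e 0) acc
    (sel (Nat.ble e 35) (List.cons (Nat.add 6 j) acc)
      (List.cons (Nat.add 6 (Nat.mod (Nat.add i 35) 72)) (sel (Nat.ble e 70) (List.cons (Nat.add 6 j) acc)
         (List.cons (Nat.add 6 (Nat.mod (Nat.add i 70) 72)) (List.cons (Nat.add 6 j) acc))))))

/-- Gift wrapping, as a list of codes. Correctness of the search does not depend on it. -/
def wrap (l : List Cand) (start : Nat) (fuel : Nat) : Cand → List Nat :=
  loop fuel (fun _ => List.nil) fun ih cur =>
    List.cons cur.p.code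
     (wrapNext (fun nx => sel (Nat.beq nx.p.code start) List.nil (ih nx)) cur l cur cur.r
      (arcNext (fun nx => arcCodes cur.ri nx.li (sel (Nat.beq nx.p.code start) List.nil (ih nx))) cur.ri l 100 cur))

def arcLen (v w : Pt) : Nat := Nat.mod (Nat.sub (Nat.add w.code 72) v.code) 72

def onGon (v w : Pt) : Bool := both (Nat.ble 6 v.code) (Nat.ble 6 w.code)

/-- Two vertices of the rectangle relative to its centre, for the middle of a range of angles, with
bounds for the sine of the deviation, the rounding and second-order error, and the displacement. -/
structure Cell where
  wx : Nat
  wy : Nat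
  zx : Nat
  zy : Nat
  tau : Nat
  xi : Nat
  rw : Nat

/-- Sums over the edges of a chain: cross products, their first derivatives in the position of the
segment and of the rectangle and in the angle, and coefficients of the error terms. -/
structure Acc where
  pos : Nat
  neg : Nat
  g1xp : Nat
  g1xn : Nat
  g1yp : Nat
  g1yn : Nat
  g2xp : Nat
  g2xn : Nat
  g2yp : Nat
  g2yn : Nat
  gtp : Nat
  gtn : Nat
  a : Nat
  kp : Nat
  kn : Nat
  kq : Nat

def Acc.step (s : Acc) (v w : Pt) : Acc :=
  sel (onGon v w)
   (Acc.rec (motive := fun _ => Acc) (fun pos neg g1xp g1xn g1yp g1yn g2xp g2xn g2yp g2yn gtp gtn a kp kn kq =>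
     ⟨Nat.add pos (Nat.mul 23149176494250 (arcLen v w)), neg, g1xp, g1xn, g1yp, g1yn, g2xp, g2xn, g2yp, g2yn, gtp, gtn, a, kp, kn, kq⟩) s)
   (Acc.rec (motive := fun _ => Acc) (fun pos neg g1xp g1xn g1yp g1yn g2xp g2xn g2yp g2yn gtp gtn a kp kn kq =>
    Pt.rec (motive := fun _ => Acc) (fun _ x y ax ay fp fq _ _ wx wy => Pt.rec (motive := fun _ => Acc) (fun _ x' y' ax' ay' fp' fq' _ _ wx' wy' =>
     ⟨Nat.add pos (Nat.add (Nat.mul x y') (Nat.mul 102400000 (Nat.add y x'))), Nat.add neg (Nat.add (Nat.mul y x') (Nat.mul 102400000 (Nat.add x y'))),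
      Nat.add g1xp (Nat.mul fp x'), Nat.add g1xn (Nat.mul fp' x), Nat.add g1yp (Nat.mul fp y'), Nat.add g1yn (Nat.mul fp' y),
      Nat.add g2xp (Nat.mul fq x'), Nat.add g2xn (Nat.mul fq' x), Nat.add g2yp (Nat.mul fq y'), Nat.add g2yn (Nat.mul fq' y),
      Nat.add gtp (Nat.add (Nat.add (Nat.mul wx x') (Nat.mul wy y')) (Nat.mul (Nat.mul 25600000 fq') (Nat.add x y))),
      Nat.add gtn (Nat.add (Nat.add (Nat.mul wx' x) (Nat.mul wy' y)) (Nat.mul (Nat.mul 25600000 fq) (Nat.add x' y'))),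
      Nat.add a (Nat.add (Nat.mul fq (Nat.add ax' ay')) (Nat.mul fq' (Nat.add ax ay))),
      Nat.add kp (Nat.mul fp fq'), Nat.add kn (Nat.mul fq fp'), Nat.add kq (Nat.mul fq fq')⟩) w) v) s)

def sums (v0 : Pt) (l : List Pt) : Pt → Acc → Acc :=
  lrec l (fun v s => s.step v v0) fun w _ ih v s => ih w (s.step v w)
/-- The edge turns counterclockwise throughout the box. -/
def edgeOk (v w : Pt) : Bool :=
  sel (onGon v w) (strict (arcLen v w) fun m => both (Nat.ble 1 m) (Nat.ble m 35)) (sure v w)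

def edgesOk (v0 : Pt) (l : List Pt) : Pt → Bool :=
  lrec l (fun v => edgeOk v v0) fun w _ ih v => sel (edgeOk v w) (ih w) false

def after (v0 : Pt) (l : List Pt) : Bool := lrec l true fun w _ ih => sel (sure w v0) ih false
/-- The vertices of `l` are first left, then right of the ray from the origin to `v0`. -/
def pattern (v0 : Pt) (l : List Pt) : Bool := lrec l true fun w t ih => sel (sure v0 w) ih (after v0 t)

/-- The chain winds once around the origin. -/
def anyRot (n : Nat) : List Pt → Bool :=
  loop n (fun _ => false) fun ih l => lrec l false fun v t _ => sel (pattern v t) true (ih (List.append t (List.cons v List.nil)))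

def points (c : Cell) (a1 a2 b1 b2 h1 h2 k1 k2 : Nat) (k : Pt → Pt → Pt → Pt → Pt → Pt → Bool) : Bool :=
  strict (Nat.add a1 h1) fun x1 => strict (Nat.add a2 h2) fun y1 => strict (Nat.add b1 k1) fun x2 => strict (Nat.add b2 k2) fun y2 =>
  strict (Nat.add k1 c.rw) fun r1 => strict (Nat.add k2 c.rw) fun r2 =>
  strict (Nat.sub 51200000 c.wx) fun wx => strict (Nat.sub 51200000 c.wy) fun wy =>
  strict (Nat.sub 51200000 c.zx) fun zx => strict (Nat.sub 51200000 c.zy) fun zy =>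
  mkPt 0 (Nat.add x1 51200000) y1 1 0 h1 h2 0 0 fun p0 => 
  mkPt 1 x1 y1 1 0 h1 h2 0 0 fun p1 =>
  mkPt 2 (Nat.add x2 c.wx) (Nat.add y2 c.wy) 0 1 r1 r2 c.wx c.wy fun p2 =>
  mkPt 3 (Nat.add x2 c.zx) (Nat.add y2 c.zy) 0 1 r1 r2 c.zx c.zy fun p3 =>
  mkPt 4 (Nat.add x2 wx) (Nat.add y2 wy) 0 1 r1 r2 wx wy fun p4 =>
  mkPt 5 (Nat.add x2 zx) (Nat.add y2 zy) 0 1 r1 r2 zx zy fun p5 => k p0 p1 p2 p3 p4 p5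

/-- With no usable candidate the chain falls back to an equilateral triangle of polygon vertices,
whose arcs make up the whole polygon. -/
def chain (p0 p1 p2 p3 p4 p5 : Pt) : List Nat :=
  (addCand p0 (addCand p1 (addCand p2 (addCand p3 (addCand p4 (addCand p5 (fun l => 
   refine (fun l => lrec l [6, 30, 54] fun c t _ => farthest (fun s => wrap l s.p.code 12 s) t c) l l List.nil)))))) List.nil)

def pred6 {α : Type} (c : Nat) (p : α) (k : Nat → α) : α := Nat.rec (motive := fun _ => α) p (fun c _ => k c) c

def pt {α : Type} (p0 p1 p2 p3 p4 p5 : Pt) (c : Nat) (f : Pt → α) : α :=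
  pred6 c (f p0) fun c => pred6 c (f p1) fun c => pred6 c (f p2) fun c => pred6 c (f p3) fun c => pred6 c (f p4) fun c => pred6 c (f p5) fun c => gonPt c f

def forceL (l : List Nat) (f : Nat → (Pt → Bool) → Bool) : (List Pt → Bool) → Bool :=
  lrec l (fun k => k List.nil) fun a _ ih k => f a fun p => ih fun t => k (List.cons p t)

def start (f : Pt → List Pt → Bool) (l : List Pt) : Bool := lrec l false fun v t _ => f v t

/-- Bisect the side of the box whose extent costs most. -/
def split (ih : Nat → Nat → Nat → Nat → Nat → Nat → Nat → Nat → Bool) (a1 a2 b1 b2 h1 h2 k1 k2 e1 e2 f1 f2 : Nat) : Bool :=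
  sel (both (both (Nat.ble e2 e1) (Nat.ble f1 e1)) (Nat.ble f2 e1))
    (strict (Nat.div (Nat.succ h1) 2) fun h => sel (ih a1 a2 b1 b2 h h2 k1 k2) (strict (Nat.add a1 h1) fun a => ih a a2 b1 b2 h h2 k1 k2) false)
  (sel (both (Nat.ble f1 e2) (Nat.ble f2 e2))
    (strict (Nat.div (Nat.succ h2) 2) fun h => sel (ih a1 a2 b1 b2 h1 h k1 k2) (strict (Nat.add a2 h2) fun a => ih a1 a b1 b2 h1 h k1 k2) false)
  (sel (Nat.ble f2 f1)
    (strict (Nat.div (Nat.succ k1) 2) fun h => sel (ih a1 a2 b1 b2 h1 h2 h k2) (strict (Nat.add b1 k1) fun a => ih a1 a2 a b2 h1 h2 h k2) false)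
    (strict (Nat.div (Nat.succ k2) 2) fun h => sel (ih a1 a2 b1 b2 h1 h2 k1 h) (strict (Nat.add b2 k2) fun a => ih a1 a2 b1 a h1 h2 k1 h) false)))

def slopes (s : Acc) (h1 h2 k1 k2 : Nat) (f : Nat → Nat → Nat → Nat → Nat → Nat → Bool) : Bool :=
  strict (Nat.mul (dist s.g1yp s.g1yn) h1) fun c1 => strict (Nat.mul (dist s.g1xp s.g1xn) h2) fun c2 =>
  strict (Nat.mul (dist s.g2yp s.g2yn) k1) fun d1 => strict (Nat.mul (dist s.g2xp s.g2xn) k2) fun d2 =>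
  strict (dist s.kp s.kn) fun k =>
  strict (Nat.mul k (Nat.mul h1 k2)) fun q1 => strict (Nat.mul k (Nat.mul h2 k1)) fun q2 => f c1 c2 d1 d2 q1 q2

/-- The area enclosed by the chain is at least `1 / 10` throughout the box. -/
def large (c : Cell) (s : Acc) (h k c1 c2 d1 d2 q1 q2 : Nat) : Bool :=
  Nat.ble (Nat.add (Nat.add s.neg (Nat.add (Nat.add (Nat.add c1 c2) (Nat.add d1 d2)) (Nat.add q1 q2)))
    (Nat.add (Nat.succ (Nat.div (Nat.mul c.tau (dist s.gtp s.gtn)) 1000000))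
      (Nat.add (Nat.add (Nat.mul c.xi s.a) (Nat.mul c.rw (Nat.add (Nat.mul (Nat.add s.kp s.kn) h) (Nat.mul 2 (Nat.mul s.kq (Nat.add k c.rw))))))
        2097152000000000))) s.pos

def cost (c q h : Nat) : Nat := Nat.add (Nat.add c (Nat.div q 2)) (Nat.mul 8192000 h)

def bisect (ih : Nat → Nat → Nat → Nat → Nat → Nat → Nat → Nat → Bool) (a1 a2 b1 b2 h1 h2 k1 k2 c1 c2 d1 d2 q1 q2 : Nat) : Bool :=
  strict (cost c1 q1 h1) fun e1 => strict (cost c2 q2 h2) fun e2 => strict (cost d1 q2 k1) fun f1 => strict (cost d2 q1 k2) fun f2 =>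
  split ih a1 a2 b1 b2 h1 h2 k1 k2 e1 e2 f1 f2

def forceAcc (s : Acc) (k : Acc → Bool) : Bool := Acc.rec (motive := fun _ => Bool) (fun pos neg g1xp g1xn g1yp g1yn g2xp g2xn g2yp g2yn gtp gtn a kp kn kq =>
    k ⟨pos, neg, g1xp, g1xn, g1yp, g1yn, g2xp, g2xn, g2yp, g2yn, gtp, gtn, a, kp, kn, kq⟩) s

/-- Bisect the box of positions of the segment and the rectangle until the area bound holds. -/
def search (c : Cell) (n : Nat) : Nat → Nat → Nat → Nat → Nat → Nat → Nat → Nat → Bool :=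
  loop n (fun _ _ _ _ _ _ _ _ => false) fun ih a1 a2 b1 b2 h1 h2 k1 k2 =>
   points c a1 a2 b1 b2 h1 h2 k1 k2 fun p0 p1 p2 p3 p4 p5 =>
   forceL (chain p0 p1 p2 p3 p4 p5) (pt p0 p1 p2 p3 p4 p5) (start fun v t =>
   forceAcc (sums v t v ⟨0,0,0,0,0,0,0,0,0,0,0,0,0,0,0,0⟩) fun s =>
   slopes s h1 h2 k1 k2 fun c1 c2 d1 d2 q1 q2 =>
   sel (both (large c s (Nat.add h1 h2) (Nat.add k1 k2) c1 c2 d1 d2 q1 q2) (both (edgesOk v t v) (anyRot 20 (List.cons v t))))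
    true (bisect ih a1 a2 b1 b2 h1 h2 k1 k2 c1 c2 d1 d2 q1 q2))

def mkCell (n0 n1 : Nat) (k : Cell → Bool) : Bool :=
  strict (Nat.add n0 n1) fun m => strict (Nat.add 16384 (Nat.mul m m)) fun d => strict (Nat.sub 16384 (Nat.mul m m)) fun e =>
  strict (Nat.div (Nat.sub (Nat.add (Nat.mul 25600000 d) (Nat.mul 16757760 e)) (Nat.mul 8842240 (Nat.mul 256 m))) d) fun wx =>
  strict (Nat.div (Nat.add (Nat.add (Nat.mul 25600000 d) (Nat.mul 8842240 e)) (Nat.mul 16757760 (Nat.mul 256 m))) d) fun wy =>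
  strict (Nat.div (Nat.add (Nat.add (Nat.mul 25600000 d) (Nat.mul 16757760 e)) (Nat.mul 8842240 (Nat.mul 256 m))) d) fun zx =>
  strict (Nat.div (Nat.sub (Nat.add (Nat.mul 25600000 d) (Nat.mul 16757760 (Nat.mul 256 m))) (Nat.mul 8842240 e)) d) fun zy =>
  strict (Nat.succ (Nat.div (Nat.mul (Nat.sub n1 n0) 64000000) (Nat.add 4096 (Nat.mul n0 n0)))) fun tau =>
  strict (Nat.add 3 (Nat.div (Nat.mul (Nat.mul tau tau) 189500000) 19000000000000)) fun xi =>
  strict (Nat.add (Nat.add xi 2) (Nat.div (Nat.mul tau 18950000) 1000000)) fun rw =>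
  k ⟨wx, wy, zx, zy, tau, xi, rw⟩

/-- The first four numbers are the lower ends of the ranges, the last four their half-widths. With
the offsets `(76800000, 102400000)` of the midpoint and `(76800000, 76800000)` of the centre, the
box is `0 ≤ X.1 ≤ 0.4`, `|X.2| ≤ 0.4` and `|Y.1|, |Y.2| ≤ 0.4375` in units of 102400000. The offset
25600000 missing from the centre is supplied by the stored corners. -/
def cellOk (n0 n1 : Nat) : Bool := mkCell n0 n1 fun c =>
  search c 50 76800000 61440000 32000000 32000000 20480000 40960000 44800000 44800000

/-! ### Error bounds for cross products and their sums over a box. -/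

theorem strict_eq {α : Type} (n : Nat) (k : Nat → α) : strict n k = k n := by cases n <;> rfl

theorem sel_eq {α : Type} (b : Bool) (t f : α) : sel b t f = if b = true then t else f := by
  cases b <;> rfl

theorem both_eq (a b : Bool) : both a b = (a && b) := by cases a <;> rfl

theorem dist_cast (a b : Nat) : (dist a b : ℝ) = |(a : ℝ) - b| := by
  have e : dist a b = (a - b) + (b - a) := rfl
  rw [e]
  rcases le_total a b with h | h
  · rw [Nat.sub_eq_zero_of_le h, zero_add, Nat.cast_sub h, abs_sub_comm, abs_of_nonneg]
    simpa using h
  · rw [Nat.sub_eq_zero_of_le h, add_zero, Nat.cast_sub h, abs_of_nonneg]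
    simpa using h

theorem abs_cross_le {a b : ℝ × ℝ} {A₁ A₂ B₁ B₂ : ℝ} (h1 : |a.1| ≤ A₁) (h2 : |a.2| ≤ A₂)
    (h3 : |b.1| ≤ B₁) (h4 : |b.2| ≤ B₂) : |cross a b| ≤ A₁ * B₂ + A₂ * B₁ := by
  unfold cross
  refine (abs_sub _ _).trans ?_
  rw [abs_mul, abs_mul]
  have := (abs_nonneg a.1).trans h1
  have := (abs_nonneg a.2).trans h2
  gcongr

/-- The displacement of the segment, of the rectangle, and the sine of its rotation. -/
structure Shift where
  u : ℝ × ℝ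
  v : ℝ × ℝ
  τ : ℝ

/-- The `k`-th vertex of the polygon inscribed in the circle. -/
def gon (k : Nat) : ℝ × ℝ :=
  (((gonPt k Pt.x : ℕ) : ℝ) - 102400000, ((gonPt k Pt.y : ℕ) : ℝ) - 102400000)

/-- The stored point `p` stands for the point `z` of the plane. -/
structure Rep (c : Cell) (σ : Shift) (p : Pt) (z : ℝ × ℝ) : Prop where
  ax : (p.ax : ℝ) = |(p.x : ℝ) - 102400000|
  ay : (p.ay : ℝ) = |(p.y : ℝ) - 102400000|
  wx : (p.fq : ℝ) * p.wx = p.wx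
  wy : (p.fq : ℝ) * p.wy = p.wy
  moved : ∃ e ξ : ℝ × ℝ, |e.1| ≤ c.rw ∧ |e.2| ≤ c.rw ∧ |ξ.1| ≤ c.xi ∧ |ξ.2| ≤ c.xi ∧
    z.1 = p.x - 102400000 + p.fp * σ.u.1 + p.fq * (σ.v.1 + e.1) ∧
    z.2 = p.y - 102400000 + p.fp * σ.u.2 + p.fq * (σ.v.2 + e.2) ∧
    p.fq * e.1 = p.fq * (-σ.τ * (p.wy - 25600000) + ξ.1) ∧
    p.fq * e.2 = p.fq * (σ.τ * (p.wx - 25600000) + ξ.2)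
  rx : |z.1 - (p.x - 102400000)| ≤ p.rx
  ry : |z.2 - (p.y - 102400000)| ≤ p.ry
  onGon : 6 ≤ p.code → p.code < 78 ∧ p.fp = 0 ∧ p.fq = 0 ∧ p.wx = 0 ∧ p.wy = 0 ∧
    z = gon (p.code - 6)

variable {c : Cell} {σ : Shift}

/-- The cross product is bilinear: about the stored midpoints it has two linear corrections and one
quadratic one, and `margin` is the sum of their bounds. -/
theorem cross_pos_of_sure {v w : Pt} {y z : ℝ × ℝ} (hv : Rep c σ v y) (hw : Rep c σ w z)
    (h : sure v w = true) : 0 < cross y z := by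
  have h1 : (crossN v w + margin v w + 1 : ℕ) ≤ crossP v w := Nat.le_of_ble_eq_true h
  have h2 : ((crossN v w : ℝ) + margin v w + 1) ≤ crossP v w := by exact_mod_cast h1
  simp only [crossN, crossP, margin, Nat.add_eq, Nat.mul_eq] at h2
  push_cast at h2
  rw [hv.ax, hv.ay, hw.ax, hw.ay] at h2
  set V : ℝ × ℝ := (v.x - 102400000, v.y - 102400000)
  set W : ℝ × ℝ := (w.x - 102400000, w.y - 102400000)
  have e1 := abs_cross_le (a := V) (b := z - W) le_rfl le_rfl hw.rx hw.ry
  have e2 := abs_cross_le (a := y - V) (b := W) hv.rx hv.ry le_rfl le_rfl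
  have e3 := abs_cross_le (a := y - V) (b := z - W) hv.rx hv.ry hw.rx hw.ry
  have e4 : cross y z = cross V W + cross V (z - W) + cross (y - V) W + cross (y - V) (z - W) := by
    simp only [cross, Prod.fst_sub, Prod.snd_sub]; ring
  have e5 : cross V W = v.x * w.y + 102400000 * (v.y + w.x)
      - (v.y * w.x + 102400000 * (v.x + w.y)) := by
    simp only [cross, V, W]; ring
  have e1 := neg_le_of_abs_le e1
  have e2 := neg_le_of_abs_le e2
  have e3 := neg_le_of_abs_le e3
  simp only [V, W] at e1 e2 e3
  rw [e4, e5]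
  linarith

/-- The area weight of an edge. -/
def weight (z : Pt → ℝ × ℝ) (v w : Pt) : ℝ :=
  if onGon v w = true then 23149176494250 * (arcLen v w : ℝ) else cross (z v) (z w)

/-- A lower bound, up to the boundary terms `potential`, of the weights summed in `s`. -/
def Acc.bound (c : Cell) (σ : Shift) (h k : ℝ) (s : Acc) : ℝ :=
  (s.pos - s.neg) + (σ.u.1 * (s.g1yp - s.g1yn) - σ.u.2 * (s.g1xp - s.g1xn))
  + (σ.v.1 * (s.g2yp - s.g2yn) - σ.v.2 * (s.g2xp - s.g2xn)) - σ.τ * (s.gtp - s.gtn) - c.xi * s.a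
  + (s.kp - s.kn) * cross σ.u σ.v - c.rw * ((s.kp + s.kn) * h + 2 * (s.kq * (k + c.rw)))

/-- The derivative sums use stored coordinates without subtracting the offset 102400000. On each
edge the discrepancy is a difference of this function at the two ends, so it cancels around a closed
chain. -/
def potential (σ : Shift) (p : Pt) : ℝ :=
  102400000 * ((σ.u.2 - σ.u.1) * p.fp + (σ.v.2 - σ.v.1) * p.fq
    + σ.τ * (p.wx + p.wy - 51200000 * p.fq))

theorem onGon_iff (v w : Pt) : onGon v w = true ↔ 6 ≤ v.code ∧ 6 ≤ w.code := by
  simp [onGon, both_eq]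

theorem Acc.step_eq (s : Acc) (v w : Pt) : s.step v w = if onGon v w = true then
    { s with pos := s.pos + 23149176494250 * arcLen v w } else
    { pos := s.pos + (v.x * w.y + 102400000 * (v.y + w.x))
      neg := s.neg + (v.y * w.x + 102400000 * (v.x + w.y))
      g1xp := s.g1xp + v.fp * w.x
      g1xn := s.g1xn + w.fp * v.x
      g1yp := s.g1yp + v.fp * w.y
      g1yn := s.g1yn + w.fp * v.y
      g2xp := s.g2xp + v.fq * w.x
      g2xn := s.g2xn + w.fq * v.x
      g2yp := s.g2yp + v.fq * w.y
      g2yn := s.g2yn + w.fq * v.y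
      gtp := s.gtp + (v.wx * w.x + v.wy * w.y + 25600000 * w.fq * (v.x + v.y))
      gtn := s.gtn + (w.wx * v.x + w.wy * v.y + 25600000 * v.fq * (w.x + w.y))
      a := s.a + (v.fq * (w.ax + w.ay) + w.fq * (v.ax + v.ay))
      kp := s.kp + v.fp * w.fq
      kn := s.kn + v.fq * w.fp
      kq := s.kq + v.fq * w.fq } := by
  unfold Acc.step
  rw [sel_eq]
  rfl

/-- The expansion about the midpoints is exact. Terms linear in the translations and in the sine of
the rotation are accumulated, as is the product of the two translations. Only the residuals `ξ` and
the products involving the rotational displacements `e` are estimated, by `i1` to `i5`. An arc of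
the polygon has constant weight and no derivative. -/
theorem bound_step_le {z : Pt → ℝ × ℝ} {v w : Pt} {h1 h2 k1 k2 : ℝ} (hv : Rep c σ v (z v))
    (hw : Rep c σ w (z w)) (hu1 : |σ.u.1| ≤ h1) (hu2 : |σ.u.2| ≤ h2) (hv1 : |σ.v.1| ≤ k1)
    (hv2 : |σ.v.2| ≤ k2) (s : Acc) :
    (s.step v w).bound c σ (h1 + h2) (k1 + k2) + potential σ v - potential σ w
      ≤ s.bound c σ (h1 + h2) (k1 + k2) + weight z v w := by
  rw [Acc.step_eq]
  unfold weight
  split_ifs with hg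
  · obtain ⟨h, h'⟩ := (onGon_iff v w).1 hg
    obtain ⟨-, a1, a2, a3, a4, -⟩ := hv.onGon h
    obtain ⟨-, b1, b2, b3, b4, -⟩ := hw.onGon h'
    simp only [Acc.bound, potential, a1, a2, a3, a4, b1, b2, b3, b4]
    push_cast
    apply le_of_eq; ring
  · obtain ⟨e, ξ, a1, a2, a3, a4, a5, a6, a7, a8⟩ := hv.moved
    obtain ⟨e', ξ', b1, b2, b3, b4, b5, b6, b7, b8⟩ := hw.moved
    have cw := hv.wx
    have cw2 := hv.wy
    have dw := hw.wx
    have dw2 := hw.wy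
    simp only [Acc.bound, potential]
    push_cast
    rw [hv.ax, hv.ay, hw.ax, hw.ay]
    set V : ℝ × ℝ := (v.x - 102400000, v.y - 102400000) with hV
    set W : ℝ × ℝ := (w.x - 102400000, w.y - 102400000) with hW
    have i1 : w.fq * -(c.xi * (|(v.x - 102400000 : ℝ)| + |(v.y - 102400000 : ℝ)|))
        ≤ w.fq * cross V ξ' := by
      gcongr
      have := neg_le_of_abs_le (abs_cross_le (a := V) (b := ξ') le_rfl le_rfl b3 b4)
      simp only [V] at this ⊢; linarith
    have i2 : v.fq * -(c.xi * (|(w.x - 102400000 : ℝ)| + |(w.y - 102400000 : ℝ)|))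
        ≤ v.fq * cross ξ W := by
      gcongr
      have := neg_le_of_abs_le (abs_cross_le (a := ξ) (b := W) a3 a4 le_rfl le_rfl)
      simp only [W] at this ⊢; linarith
    have i3 : (v.fp * w.fq : ℝ) * -(c.rw * (h1 + h2)) ≤ (v.fp * w.fq) * cross σ.u e' := by
      gcongr
      have := neg_le_of_abs_le (abs_cross_le hu1 hu2 b1 b2)
      linarith
    have i4 : (v.fq * w.fp : ℝ) * -(c.rw * (h1 + h2)) ≤ (v.fq * w.fp) * cross e σ.u := by
      gcongr
      have := neg_le_of_abs_le (abs_cross_le a1 a2 hu1 hu2)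
      linarith
    have i5 : (v.fq * w.fq : ℝ) * -(c.rw * (2 * (k1 + k2 + c.rw)))
        ≤ (v.fq * w.fq) * (cross σ.v e' + cross e σ.v + cross e e') := by
      gcongr
      have := neg_le_of_abs_le (abs_cross_le hv1 hv2 b1 b2)
      have := neg_le_of_abs_le (abs_cross_le a1 a2 hv1 hv2)
      have := neg_le_of_abs_le (abs_cross_le a1 a2 b1 b2)
      linarith
    have key : cross (z v) (z w) = cross V W
        + (v.fp * cross σ.u W + w.fp * cross V σ.u) + (v.fq * cross σ.v W + w.fq * cross V σ.v)
        + ((v.fq * e.1) * W.2 - (v.fq * e.2) * W.1) + (V.1 * (w.fq * e'.2) - V.2 * (w.fq * e'.1))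
        + (v.fp * w.fq - v.fq * w.fp) * cross σ.u σ.v
        + (v.fp * w.fq) * cross σ.u e' + (v.fq * w.fp) * cross e σ.u
        + (v.fq * w.fq) * (cross σ.v e' + cross e σ.v + cross e e') := by
      have : z v = (V.1 + v.fp * σ.u.1 + v.fq * (σ.v.1 + e.1),
        V.2 + v.fp * σ.u.2 + v.fq * (σ.v.2 + e.2)) := Prod.ext a5 a6
      rw [this]
      have : z w = (W.1 + w.fp * σ.u.1 + w.fq * (σ.v.1 + e'.1),
        W.2 + w.fp * σ.u.2 + w.fq * (σ.v.2 + e'.2)) := Prod.ext b5 b6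
      rw [this]
      simp only [cross]; ring
    have key2 : ((v.fq * e.1) * W.2 - (v.fq * e.2) * W.1)
          + (V.1 * (w.fq * e'.2) - V.2 * (w.fq * e'.1))
        = v.fq * cross ξ W + w.fq * cross V ξ'
          - σ.τ * (((v.fq * v.wx - 25600000 * v.fq) * W.1 + (v.fq * v.wy - 25600000 * v.fq) * W.2)
            - ((w.fq * w.wx - 25600000 * w.fq) * V.1 + (w.fq * w.wy - 25600000 * w.fq) * V.2)) := by
      rw [a7, a8, b7, b8]
      simp only [cross]; ring
    rw [cw, cw2, dw, dw2] at key2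
    rw [← sub_nonneg]
    rw [← sub_nonneg] at i1 i2 i3 i4 i5
    have := add_nonneg (add_nonneg (add_nonneg (add_nonneg i1 i2) i3) i4) i5
    refine this.trans (le_of_eq ?_)
    rw [key]
    rw [add_assoc (cross V W + _ + _), key2]
    simp only [V, W, cross]
    ring

variable {c : Cell} {σ : Shift} {K : Set (ℝ × ℝ)} {z : Pt → ℝ × ℝ}

theorem bound_sums_le {h1 h2 k1 k2 : ℝ} (hu1 : |σ.u.1| ≤ h1) (hu2 : |σ.u.2| ≤ h2)
    (hv1 : |σ.v.1| ≤ k1) (hv2 : |σ.v.2| ≤ k2) {v₀ : Pt} (h₀ : Rep c σ v₀ (z v₀)) (l : List Pt) :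
    ∀ v s, Rep c σ v (z v) → (∀ w ∈ l, Rep c σ w (z w)) →
      (sums v₀ l v s).bound c σ (h1 + h2) (k1 + k2) + potential σ v - potential σ v₀
        ≤ s.bound c σ (h1 + h2) (k1 + k2) + pathSum (weight z) v (l ++ [v₀]) := by
  induction l with
  | nil =>
    intro v s hv _
    have := bound_step_le hv h₀ hu1 hu2 hv1 hv2 s
    simpa [pathSum, sums, lrec] using this
  | cons w l ih =>
    intro v s hv hl
    have hw := hl w (by simp)
    have h3 := ih w (s.step v w) hw (fun x hx => hl x (by simp [hx]))
    have h4 := bound_step_le hv hw hu1 hu2 hv1 hv2 s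
    have e : sums v₀ (w :: l) v s = sums v₀ l w (s.step v w) := rfl
    rw [e]
    simp only [List.cons_append, pathSum]
    linarith

/-! ### The 72-gon inscribed in the disc. -/

/-- `gon (k + m)` lies counterclockwise from `gon k`, less than half a turn away. -/
def gonConvex : Bool :=
  lrec (List.range 72) true fun k _ ih => sel (lrec (List.range 35) true fun m _ ih' =>
    gonPt k fun p => gonPt (Nat.add k (Nat.succ m)) fun q =>
      sel (Nat.ble (Nat.succ (crossN p q)) (crossP p q)) ih' false) ih false

/-- Consecutive vertices of the polygon span triangles of the required area. -/
def gonArea : Bool :=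
  lrec (List.range 72) true fun k _ ih => gonPt k fun p => gonPt (Nat.succ k) fun q =>
    sel (Nat.ble (Nat.add (crossN p q) 23149176494250) (crossP p q)) ih false

def gonInDisc : Bool :=
  lrec (List.range 72) true fun k _ ih => gonPt k fun p =>
    sel (Nat.ble (Nat.add (Nat.mul p.ax p.ax) (Nat.mul p.ay p.ay)) 265607202451600) ih false

theorem gonConvex_eq : gonConvex = true := by decide +kernel

theorem gonArea_eq : gonArea = true := by decide +kernel

theorem gonInDisc_eq : gonInDisc = true := by decide +kernel

/-- A false tail can never become true again, so a true fold has only true tails and each element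
passes its own test. -/
theorem lrec_true {β : Type} (f : β → Bool → Bool) (hf : ∀ b x, f b x = true → x = true)
    (l : List β) (h : lrec l true (fun b _ ih => f b ih) = true) : ∀ b ∈ l, f b true = true := by
  induction l with
  | nil => simp
  | cons a l ih =>
    have e : lrec (a :: l) true (fun b _ ih => f b ih)
      = f a (lrec l true (fun b _ ih => f b ih)) := rfl
    rw [e] at h
    have h' := hf _ _ h
    intro b hb
    rcases List.mem_cons.1 hb with rfl | hb
    · rwa [h'] at h
    · exact ih h' b hb

theorem mkPt_eq {α : Type} (code x y fp fq rx ry wx wy : Nat) (f : Pt → α) :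
    mkPt code x y fp fq rx ry wx wy f
      = f ⟨code, x, y, dist x 102400000, dist y 102400000, fp, fq, rx, ry, wx, wy⟩ := by
  simp only [mkPt, strict_eq]

/-- The program passes results to continuations; this recovers ordinary application. The lemmas
`pt_eq` and `forceL_eq` play the same part. -/
theorem gonPt_eq {α : Type} (k : Nat) (f : Pt → α) : gonPt k f = f (gonPt k id) := by
  simp only [gonPt, strict_eq, mkPt_eq, id]

theorem gonPt_mod (k : Nat) : gonPt (k % 72) id = gonPt k id := by
  simp only [gonPt, strict_eq, mkPt_eq, id]
  have : Nat.mod (k % 72) 72 = Nat.mod k 72 := Nat.mod_mod k 72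
  rw [this]

theorem gonPt_code (k : Nat) : (gonPt k id).code = 6 + k % 72 := by
  simp only [gonPt, strict_eq, mkPt_eq, id]; rfl

theorem gon_mod (k : Nat) : gon (k % 72) = gon k := by
  unfold gon
  rw [gonPt_eq _ Pt.x, gonPt_eq _ Pt.y, gonPt_mod, ← gonPt_eq _ Pt.x, ← gonPt_eq _ Pt.y]

theorem rep_gonPt (k : Nat) : Rep c σ (gonPt k id) (gon k) := by
  have hx : (gonPt k Pt.x) = (gonPt k id).x := gonPt_eq k Pt.x
  have hy : (gonPt k Pt.y) = (gonPt k id).y := gonPt_eq k Pt.y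
  have hc := gonPt_code k
  have h : ∃ a x y, gonPt k id
      = ⟨a, x, y, dist x 102400000, dist y 102400000, 0, 0, 0, 0, 0, 0⟩ := by
    simp only [gonPt, strict_eq, mkPt_eq, id]
    exact ⟨_, _, _, rfl⟩
  have hg : gon ((gonPt k id).code - 6) = gon k := by
    rw [hc, Nat.add_sub_cancel_left, gon_mod]
  obtain ⟨a, x, y, h⟩ := h
  rw [h] at hx hy hc hg
  rw [h]
  constructor <;> simp only [gon, hx, hy]
  · simp [dist_cast]
  · simp [dist_cast]
  · simp
  · simp
  · exact ⟨0, 0, by simp⟩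
  · simp
  · simp
  · intro _
    simp only at hc hg
    refine ⟨by omega, trivial, trivial, trivial, trivial, ?_⟩
    change _ = gon (a - 6)
    rw [hg, gon, hx, hy]

theorem cross_gon (j k : Nat) : cross (gon j) (gon k)
    = (crossP (gonPt j id) (gonPt k id) : ℝ) - crossN (gonPt j id) (gonPt k id) := by
  unfold gon
  rw [gonPt_eq j Pt.x, gonPt_eq j Pt.y, gonPt_eq k Pt.x, gonPt_eq k Pt.y]
  simp only [cross, crossP, crossN, Nat.add_eq, Nat.mul_eq]
  push_cast; ring

theorem cross_gon_pos (k : Nat) {m : Nat} (h1 : 1 ≤ m) (h2 : m ≤ 35) :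
    0 < cross (gon k) (gon (k + m)) := by
  have h := lrec_true _ (by intro b x; rw [sel_eq]; split_ifs <;> simp) _ gonConvex_eq (k % 72)
    (by simp [Nat.mod_lt])
  rw [sel_eq] at h
  split_ifs at h with h'
  have h := lrec_true _ (by
    intro b x; rw [gonPt_eq, gonPt_eq _ (fun q => _), sel_eq]; split_ifs <;> simp) _ h' (m - 1)
    (by simp; omega)
  rw [gonPt_eq, gonPt_eq _ (fun q => _), sel_eq] at h
  split_ifs at h with h'
  have h := Nat.le_of_ble_eq_true h'
  have e : Nat.add (k % 72) (Nat.succ (m - 1)) = k % 72 + m := by simp; omega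
  rw [e, gonPt_mod, ← gonPt_mod (k % 72 + m), Nat.mod_add_mod, gonPt_mod] at h
  rw [cross_gon, sub_pos]
  exact_mod_cast h

theorem le_cross_gon (k : Nat) : 23149176494250 ≤ cross (gon k) (gon (k + 1)) := by
  have h := lrec_true _ (by
    intro b x; rw [gonPt_eq, gonPt_eq _ (fun q => _), sel_eq]; split_ifs <;> simp) _ gonArea_eq
    (k % 72) (by simp [Nat.mod_lt])
  rw [gonPt_eq, gonPt_eq _ (fun q => _), sel_eq] at h
  split_ifs at h with h'
  have h := Nat.le_of_ble_eq_true h'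
  have e : Nat.succ (k % 72) = k % 72 + 1 := rfl
  rw [e, gonPt_mod, ← gonPt_mod (k % 72 + 1), Nat.mod_add_mod, gonPt_mod] at h
  rw [cross_gon, le_sub_iff_add_le, add_comm]
  exact_mod_cast h

theorem gon_mem_disc (k : Nat) :
    (gon k).1 ^ 2 + (gon k).2 ^ 2 ≤ 265607202451600 := by
  have h := lrec_true _ (by
    intro b x; rw [gonPt_eq, sel_eq]; split_ifs <;> simp) _ gonInDisc_eq
    (k % 72) (by simp [Nat.mod_lt])
  rw [gonPt_eq, sel_eq] at h
  split_ifs at h with h'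
  have h := Nat.le_of_ble_eq_true h'
  rw [gonPt_mod] at h
  have h : (((gonPt k id).ax * (gonPt k id).ax + (gonPt k id).ay * (gonPt k id).ay : ℕ) : ℝ)
      ≤ (265607202451600 : ℕ) := Nat.cast_le.2 h
  have r := rep_gonPt (c := ⟨0, 0, 0, 0, 0, 0, 0⟩) (σ := ⟨0, 0, 0⟩) k
  push_cast at h
  rw [r.ax, r.ay, abs_mul_abs_self, abs_mul_abs_self] at h
  unfold gon
  rw [gonPt_eq k Pt.x, gonPt_eq k Pt.y]
  linarith

/-- The sectors over single polygon edges add up, so an arc is credited with its whole fan of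
triangles and not merely with the triangle over its chord. Merging stops before half a turn. -/
theorem le_sector_gon (hc : Convex ℝ K) (hK : volume K ≠ ⊤) (h0 : (0 : ℝ × ℝ) ∈ K)
    (hg : ∀ k, gon k ∈ K) (k : Nat) : ∀ m, m < 35 →
    23149176494250 * ((m + 1 : ℕ) : ℝ) ≤ sector K (gon k) (gon (k + (m + 1))) := by
  intro m
  induction m with
  | zero =>
    intro _
    have := cross_le_sector hc hK h0 (hg k) (hg (k + 1))
    have := le_cross_gon k
    simp; linarith
  | succ m ih =>
    intro hm
    have h1 := ih (by omega)
    have h2 := cross_le_sector hc hK h0 (hg (k + (m + 1))) (hg (k + (m + 1) + 1))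
    have h3 := le_cross_gon (k + (m + 1))
    have h4 := sector_add_le hK (cross_gon_pos k (m := m + 1) (by omega) (by omega))
      (cross_gon_pos (k + (m + 1)) le_rfl (by norm_num))
      (cross_gon_pos k (m := m + 1 + 1) (by omega) (by omega)).le
    push_cast at h1 ⊢
    rw [show k + (m + 1) + 1 = k + (m + 1 + 1) by ring] at h2 h3 h4
    linarith

/-! ### Soundness of the tests on a chain. -/

theorem edge_of_edgeOk (hc : Convex ℝ K) (hK : volume K ≠ ⊤) (h0 : (0 : ℝ × ℝ) ∈ K)
    (hg : ∀ k, gon k ∈ K) {v w : Pt} (hv : Rep c σ v (z v)) (hw : Rep c σ w (z w))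
    (hvK : z v ∈ K) (hwK : z w ∈ K) (h : edgeOk v w = true) : Edge K z (weight z) v w := by
  unfold edgeOk at h
  rw [sel_eq] at h
  unfold Edge weight
  split_ifs at h ⊢ with h'
  · rw [strict_eq, both_eq, Bool.and_eq_true, Nat.ble_eq, Nat.ble_eq] at h
    obtain ⟨i1, i2⟩ := (onGon_iff v w).1 h'
    obtain ⟨j1, -, -, -, -, j2⟩ := hv.onGon i1
    obtain ⟨k1, -, -, -, -, k2⟩ := hw.onGon i2
    have e : arcLen v w = (w.code + 72 - v.code) % 72 := rfl
    have : gon (w.code - 6) = gon (v.code - 6 + arcLen v w) := by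
      rw [← gon_mod (v.code - 6 + arcLen v w), ← gon_mod (w.code - 6)]
      congr 1
      omega
    rw [j2, k2, this]
    refine ⟨cross_gon_pos _ h.1 h.2, ?_⟩
    obtain ⟨m, hm⟩ : ∃ m, arcLen v w = m + 1 := ⟨arcLen v w - 1, by omega⟩
    rw [hm]
    exact le_sector_gon hc hK h0 hg _ m (by omega)
  · exact ⟨cross_pos_of_sure hv hw h, cross_le_sector hc hK h0 hvK hwK⟩

theorem isChain_of_edgesOk (hc : Convex ℝ K) (hK : volume K ≠ ⊤) (h0 : (0 : ℝ × ℝ) ∈ K)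
    (hg : ∀ k, gon k ∈ K) {v₀ : Pt} (h₀ : Rep c σ v₀ (z v₀) ∧ z v₀ ∈ K) (l : List Pt) :
    ∀ v, (Rep c σ v (z v) ∧ z v ∈ K) → (∀ w ∈ l, Rep c σ w (z w) ∧ z w ∈ K) →
      edgesOk v₀ l v = true → List.IsChain (Edge K z (weight z)) (v :: (l ++ [v₀])) := by
  induction l with
  | nil =>
    intro v hv _ h
    have := edge_of_edgeOk hc hK h0 hg hv.1 h₀.1 hv.2 h₀.2 h
    simpa using this
  | cons w l ih =>
    intro v hv hl h
    have hw := hl w (by simp)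
    have e : edgesOk v₀ (w :: l) v = sel (edgeOk v w) (edgesOk v₀ l w) false := rfl
    rw [e, sel_eq] at h
    split_ifs at h with h'
    simp only [List.cons_append, List.isChain_cons_cons]
    exact ⟨edge_of_edgeOk hc hK h0 hg hv.1 hw.1 hv.2 hw.2 h',
      ih w hw (fun x hx => hl x (by simp [hx])) h⟩

/-- The one vertex at which `sure v₀ w` fails may have any sign; `Turns` allows exactly one such
vertex. -/
theorem turns_of_pattern {v₀ : Pt} (h₀ : Rep c σ v₀ (z v₀)) (l : List Pt) :
    (∀ w ∈ l, Rep c σ w (z w)) → pattern v₀ l = true → Turns z v₀ l := by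
  have after_sound : ∀ l : List Pt, (∀ w ∈ l, Rep c σ w (z w)) → after v₀ l = true →
      ∀ w ∈ l, 0 < cross (z w) (z v₀) := by
    intro l
    induction l with
    | nil => simp
    | cons w l ih =>
      intro hl h
      have e : after v₀ (w :: l) = sel (sure w v₀) (after v₀ l) false := rfl
      rw [e, sel_eq] at h
      split_ifs at h with h'
      intro x hx
      rcases List.mem_cons.1 hx with rfl | hx
      · exact cross_pos_of_sure (hl x (by simp)) h₀ h'
      · exact ih (fun x hx => hl x (by simp [hx])) h x hx
  induction l with
  | nil => intros; trivial
  | cons w l ih =>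
    intro hl h
    have e : pattern v₀ (w :: l) = sel (sure v₀ w) (pattern v₀ l) (after v₀ l) := rfl
    rw [e, sel_eq] at h
    have hl' : ∀ x ∈ l, Rep c σ x (z x) := fun x hx => hl x (by simp [hx])
    split_ifs at h with h'
    · exact Or.inl ⟨cross_pos_of_sure h₀ (hl w (by simp)) h', ih hl' h⟩
    · exact Or.inr (after_sound l hl' h)

/-- The sum around a closed chain does not depend on the starting vertex, whereas the sign pattern
may be certifiable from some vertices only. Rotating the list moves the first edge to the end. -/
theorem pathSum_le_of_anyRot (hK : volume K ≠ ⊤) (n : Nat) :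
    ∀ v l, (∀ w ∈ v :: l, Rep c σ w (z w)) →
      List.IsChain (Edge K z (weight z)) (v :: (l ++ [v])) → anyRot n (v :: l) = true →
      pathSum (weight z) v (l ++ [v]) ≤ 2 * volume.real K := by
  induction n with
  | zero => intro v l _ _ h; exact absurd h (by simp [anyRot, loop])
  | succ n ih =>
    intro v l hl hch h
    have e : anyRot (n + 1) (v :: l) = sel (pattern v l) true (anyRot n (l ++ [v])) := rfl
    rw [e, sel_eq] at h
    split_ifs at h with h'
    · exact pathSum_closed_le hK v l hch
        (turns_of_pattern (hl v (by simp)) l (fun x hx => hl x (by simp [hx])) h')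
    · cases l with
      | nil => exact ih v [] hl hch h
      | cons w l =>
        have := ih w (l ++ [v]) (fun x hx => hl x (by simp at hx ⊢; tauto)) (by
          simp only [List.cons_append, List.isChain_cons_cons, List.append_assoc] at hch ⊢
          obtain ⟨h1, h2⟩ := hch
          have : w :: (l ++ [v, w]) = (w :: (l ++ [v])) ++ [w] := by simp
          rw [List.nil_append, this]
          refine List.IsChain.append h2 (List.isChain_singleton _) ?_
          intro x hx y hy
          rw [← List.cons_append, List.getLast?_concat] at hx
          simp at hx hy
          rwa [← hx, ← hy]) h
        rw [List.append_assoc, List.cons_append, List.nil_append, pathSum_concat] at this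
        simp only [List.cons_append, pathSum]
        linarith

/-! ### Soundness of the bisection. -/

/-- Scaled by `102400000`, the set `K` contains the disc of perimeter `1` around the origin, the
segment with midpoint coded by `x`, and the rectangle with centre coded by `y` that is rotated by
an angle of the cell `c`. -/
structure Placed (c : Cell) (K : Set (ℝ × ℝ)) (x y : ℝ × ℝ) (τ : ℝ) (ξ ζ : ℝ × ℝ) : Prop where
  convex : Convex ℝ K
  finite : volume K ≠ ⊤
  disc : ∀ p : ℝ × ℝ, p.1 ^ 2 + p.2 ^ 2 ≤ 265607202451600 → p ∈ K
  right : (x.1 - 51200000, x.2 - 102400000) ∈ K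
  left : (x.1 - 102400000, x.2 - 102400000) ∈ K
  q1 : (y.1 + (c.wx + (-τ * (c.wy - 25600000) + ξ.1)) - 102400000,
    y.2 + (c.wy + (τ * (c.wx - 25600000) + ξ.2)) - 102400000) ∈ K
  q2 : (y.1 + (c.zx + (-τ * (c.zy - 25600000) + ζ.1)) - 102400000,
    y.2 + (c.zy + (τ * (c.zx - 25600000) + ζ.2)) - 102400000) ∈ K
  q3 : (y.1 + (51200000 - (c.wx + (-τ * (c.wy - 25600000) + ξ.1))) - 102400000,
    y.2 + (51200000 - (c.wy + (τ * (c.wx - 25600000) + ξ.2))) - 102400000) ∈ K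
  q4 : (y.1 + (51200000 - (c.zx + (-τ * (c.zy - 25600000) + ζ.1))) - 102400000,
    y.2 + (51200000 - (c.zy + (τ * (c.zx - 25600000) + ζ.2))) - 102400000) ∈ K
  wx : c.wx ≤ 51200000
  wy : c.wy ≤ 51200000
  zx : c.zx ≤ 51200000
  zy : c.zy ≤ 51200000
  tau : |τ| * 1000000 ≤ c.tau
  ξ₁ : |ξ.1| ≤ c.xi
  ξ₂ : |ξ.2| ≤ c.xi
  ζ₁ : |ζ.1| ≤ c.xi
  ζ₂ : |ζ.2| ≤ c.xi
  w₁ : |-τ * (c.wy - 25600000) + ξ.1| ≤ c.rw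
  w₂ : |τ * (c.wx - 25600000) + ξ.2| ≤ c.rw
  z₁ : |-τ * (c.zy - 25600000) + ζ.1| ≤ c.rw
  z₂ : |τ * (c.zx - 25600000) + ζ.2| ≤ c.rw

variable {c : Cell} {σ : Shift} {K : Set (ℝ × ℝ)}

def segPt (code x y h1 h2 : Nat) : Pt :=
  ⟨code, x, y, dist x 102400000, dist y 102400000, 1, 0, h1, h2, 0, 0⟩

def rectPt (code x y r1 r2 wx wy : Nat) : Pt :=
  ⟨code, x + wx, y + wy, dist (x + wx) 102400000, dist (y + wy) 102400000, 0, 1, r1, r2, wx, wy⟩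

theorem points_eq (c : Cell) (a1 a2 b1 b2 h1 h2 k1 k2 : Nat)
    (k : Pt → Pt → Pt → Pt → Pt → Pt → Bool) : points c a1 a2 b1 b2 h1 h2 k1 k2 k =
    k (segPt 0 (a1 + h1 + 51200000) (a2 + h2) h1 h2) (segPt 1 (a1 + h1) (a2 + h2) h1 h2)
      (rectPt 2 (b1 + k1) (b2 + k2) (k1 + c.rw) (k2 + c.rw) c.wx c.wy)
      (rectPt 3 (b1 + k1) (b2 + k2) (k1 + c.rw) (k2 + c.rw) c.zx c.zy)
      (rectPt 4 (b1 + k1) (b2 + k2) (k1 + c.rw) (k2 + c.rw) (51200000 - c.wx) (51200000 - c.wy))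
      (rectPt 5 (b1 + k1) (b2 + k2) (k1 + c.rw) (k2 + c.rw) (51200000 - c.zx) (51200000 - c.zy)) := by
  simp only [points, strict_eq, mkPt_eq]
  rfl

theorem rep_segPt {code x y h1 h2 : Nat} (hcode : code < 6) {p : ℝ × ℝ}
    (e1 : p.1 = x - 102400000 + σ.u.1) (e2 : p.2 = y - 102400000 + σ.u.2)
    (hu1 : |σ.u.1| ≤ h1) (hu2 : |σ.u.2| ≤ h2) : Rep c σ (segPt code x y h1 h2) p := by
  constructor
  · simp [segPt, dist_cast]
  · simp [segPt, dist_cast]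
  · simp [segPt]
  · simp [segPt]
  · exact ⟨0, 0, by simp [segPt, e1, e2]⟩
  · simpa [segPt, e1] using hu1
  · simpa [segPt, e2] using hu2
  · intro h; simp only [segPt] at h; omega

theorem rep_rectPt {code x y k1 k2 wx wy : Nat} (hcode : code < 6) {p ξ : ℝ × ℝ}
    (e1 : p.1 = x + σ.v.1 + (wx + (-σ.τ * (wy - 25600000) + ξ.1)) - 102400000)
    (e2 : p.2 = y + σ.v.2 + (wy + (σ.τ * (wx - 25600000) + ξ.2)) - 102400000)
    (hv1 : |σ.v.1| ≤ k1) (hv2 : |σ.v.2| ≤ k2) (hξ1 : |ξ.1| ≤ c.xi) (hξ2 : |ξ.2| ≤ c.xi)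
    (hr1 : |-σ.τ * (wy - 25600000) + ξ.1| ≤ c.rw) (hr2 : |σ.τ * (wx - 25600000) + ξ.2| ≤ c.rw) :
    Rep c σ (rectPt code x y (k1 + c.rw) (k2 + c.rw) wx wy) p := by
  constructor
  · simp [rectPt, dist_cast]
  · simp [rectPt, dist_cast]
  · simp [rectPt]
  · simp [rectPt]
  · refine ⟨(-σ.τ * (wy - 25600000) + ξ.1, σ.τ * (wx - 25600000) + ξ.2), ξ, hr1, hr2, hξ1, hξ2,
      ?_, ?_, rfl, rfl⟩ <;> simp only [rectPt] <;> push_cast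
    · rw [e1]; ring
    · rw [e2]; ring
  · simp only [rectPt]
    push_cast
    rw [e1]
    have := abs_add_le σ.v.1 (-σ.τ * (wy - 25600000) + ξ.1)
    rw [show (x + σ.v.1 + (wx + (-σ.τ * (wy - 25600000) + ξ.1)) - 102400000
      - (x + wx - 102400000) : ℝ) = σ.v.1 + (-σ.τ * (wy - 25600000) + ξ.1) by ring]
    linarith
  · simp only [rectPt]
    push_cast
    rw [e2]
    have := abs_add_le σ.v.2 (σ.τ * (wx - 25600000) + ξ.2)
    rw [show (y + σ.v.2 + (wy + (σ.τ * (wx - 25600000) + ξ.2)) - 102400000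
      - (y + wy - 102400000) : ℝ) = σ.v.2 + (σ.τ * (wx - 25600000) + ξ.2) by ring]
    linarith
  · intro h; simp only [rectPt] at h; omega

theorem forceL_eq (l : List Nat) (f : Nat → (Pt → Bool) → Bool) (g : Nat → Pt)
    (hf : ∀ a k, f a k = k (g a)) : ∀ k, forceL l f k = k (l.map g) := by
  induction l with
  | nil => intro k; rfl
  | cons a l ih =>
    intro k
    have e : forceL (a :: l) f k = f a fun p => forceL l f fun t => k (p :: t) := rfl
    rw [e, hf, ih]
    rfl

theorem pt_eq {α : Type} (p0 p1 p2 p3 p4 p5 : Pt) (f : Pt → α) :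
    ∀ n, pt p0 p1 p2 p3 p4 p5 n f = f (pt p0 p1 p2 p3 p4 p5 n id)
  | 0 | 1 | 2 | 3 | 4 | 5 => rfl
  | n + 6 => gonPt_eq n f

theorem search_succ (c : Cell) (n a1 a2 b1 b2 h1 h2 k1 k2 : Nat) :
    search c (n + 1) a1 a2 b1 b2 h1 h2 k1 k2 =
   points c a1 a2 b1 b2 h1 h2 k1 k2 fun p0 p1 p2 p3 p4 p5 =>
   forceL (chain p0 p1 p2 p3 p4 p5) (pt p0 p1 p2 p3 p4 p5) (start fun v t =>
   forceAcc (sums v t v ⟨0,0,0,0,0,0,0,0,0,0,0,0,0,0,0,0⟩) fun s =>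
   slopes s h1 h2 k1 k2 fun c1 c2 d1 d2 q1 q2 =>
   sel (both (large c s (Nat.add h1 h2) (Nat.add k1 k2) c1 c2 d1 d2 q1 q2)
     (both (edgesOk v t v) (anyRot 20 (List.cons v t))))
    true (bisect (search c n) a1 a2 b1 b2 h1 h2 k1 k2 c1 c2 d1 d2 q1 q2)) := rfl

theorem start_cons (f : Pt → List Pt → Bool) (v : Pt) (l : List Pt) :
    start f (v :: l) = f v l := rfl

theorem forceAcc_eq (s : Acc) (k : Acc → Bool) : forceAcc s k = k s := rfl

/-- Each linear term is replaced by its worst value for a shift within the half-widths, and the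
integer quotient in the rotation term is rounded up. -/
theorem le_bound_of_large {h1 h2 k1 k2 : Nat} {s : Acc}
    (hu1 : |σ.u.1| ≤ h1) (hu2 : |σ.u.2| ≤ h2) (hv1 : |σ.v.1| ≤ k1) (hv2 : |σ.v.2| ≤ k2)
    (ht : |σ.τ| * 1000000 ≤ c.tau)
    (h : slopes s h1 h2 k1 k2 (large c s (Nat.add h1 h2) (Nat.add k1 k2)) = true) :
    2097152000000000 ≤ s.bound c σ (h1 + h2) (k1 + k2) := by
  simp only [slopes, strict_eq, large, Nat.add_eq, Nat.mul_eq] at h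
  have h := Nat.le_of_ble_eq_true h
  have h : ((_ : ℕ) : ℝ) ≤ ((_ : ℕ) : ℝ) := Nat.cast_le.2 h
  push_cast at h
  have hq : |σ.τ| * dist s.gtp s.gtn
      ≤ ((Nat.div (c.tau * dist s.gtp s.gtn) 1000000 : ℕ) : ℝ) + 1 := by
    have e1 : c.tau * dist s.gtp s.gtn
        < (Nat.div (c.tau * dist s.gtp s.gtn) 1000000 + 1) * 1000000 := by
      change _ < (_ / 1000000 + 1) * 1000000
      omega
    have e2 : ((c.tau * dist s.gtp s.gtn : ℕ) : ℝ)
        < (((Nat.div (c.tau * dist s.gtp s.gtn) 1000000 + 1) * 1000000 : ℕ) : ℝ) :=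
      Nat.cast_lt.2 e1
    push_cast at e2
    have := mul_le_mul_of_nonneg_right ht (Nat.cast_nonneg (α := ℝ) (dist s.gtp s.gtn))
    linarith
  rw [dist_cast] at hq
  simp only [dist_cast] at h
  have mul_le : ∀ {a b A : ℝ}, |a| ≤ A → -(|b| * A) ≤ a * b ∧ a * b ≤ |b| * A := by
    intro a b A ha
    rw [← abs_le, abs_mul, mul_comm]
    exact mul_le_mul_of_nonneg_left ha (abs_nonneg b)
  have i1 := (mul_le hu1 (b := (s.g1yp : ℝ) - s.g1yn)).1
  have i2 := (mul_le hu2 (b := (s.g1xp : ℝ) - s.g1xn)).2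
  have i3 := (mul_le hv1 (b := (s.g2yp : ℝ) - s.g2yn)).1
  have i4 := (mul_le hv2 (b := (s.g2xp : ℝ) - s.g2xn)).2
  have i5 := (mul_le (le_refl |σ.τ|) (b := (s.gtp : ℝ) - s.gtn)).2
  have i6 := (mul_le (abs_cross_le hu1 hu2 hv1 hv2) (b := (s.kp : ℝ) - s.kn)).1
  unfold Acc.bound
  have e : ((Nat.div (c.tau * dist s.gtp s.gtn) 1000000).succ : ℝ) = 
    ((Nat.div (c.tau * dist s.gtp s.gtn) 1000000 : ℕ) : ℝ) + 1 := by push_cast; ring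
  linarith

/-- The interval of midpoint `a + h` and half-width `h`. -/
def Inside (a h : Nat) (t : ℝ) : Prop := (a : ℝ) ≤ t ∧ t ≤ a + 2 * h

/-- Half-widths are halved rounding up, so the two parts may overlap but leave no gap. -/
theorem Inside.halves {a h : Nat} {t : ℝ} (H : Inside a h t) :
    Inside a (Nat.div (Nat.succ h) 2) t ∨ Inside (Nat.add a h) (Nat.div (Nat.succ h) 2) t := by
  have e : (h : ℝ) ≤ 2 * (Nat.div (Nat.succ h) 2 : ℕ) := by
    have : h ≤ 2 * (Nat.div (Nat.succ h) 2) := by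
      change h ≤ 2 * ((h + 1) / 2)
      omega
    exact_mod_cast this
  obtain ⟨h1, h2⟩ := H
  unfold Inside
  rw [Nat.add_eq]
  push_cast
  rcases le_total t (a + h) with h3 | h3
  · left; constructor <;> linarith
  · right; constructor <;> linarith

theorem Inside.abs_le {a h : Nat} {t : ℝ} (H : Inside a h t) : |t - (a + h)| ≤ h := by
  obtain ⟨h1, h2⟩ := H
  rw [_root_.abs_le]
  constructor <;> linarith

theorem exists_of_split {f : Nat → Nat → Nat → Nat → Nat → Nat → Nat → Nat → Bool}
    {a1 a2 b1 b2 h1 h2 k1 k2 e1 e2 f1 f2 : Nat} {x y : ℝ × ℝ}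
    (h : split f a1 a2 b1 b2 h1 h2 k1 k2 e1 e2 f1 f2 = true)
    (i1 : Inside a1 h1 x.1) (i2 : Inside a2 h2 x.2) (j1 : Inside b1 k1 y.1)
    (j2 : Inside b2 k2 y.2) : ∃ a1 a2 b1 b2 h1 h2 k1 k2, f a1 a2 b1 b2 h1 h2 k1 k2 = true ∧
      Inside a1 h1 x.1 ∧ Inside a2 h2 x.2 ∧ Inside b1 k1 y.1 ∧ Inside b2 k2 y.2 := by
  unfold split at h
  simp only [strict_eq, sel_eq] at h
  split_ifs at h
  · rcases i1.halves with i | i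
    exacts [⟨_, _, _, _, _, _, _, _, ‹_›, i, i2, j1, j2⟩, ⟨_, _, _, _, _, _, _, _, h, i, i2, j1, j2⟩]
  · rcases i2.halves with i | i
    exacts [⟨_, _, _, _, _, _, _, _, ‹_›, i1, i, j1, j2⟩, ⟨_, _, _, _, _, _, _, _, h, i1, i, j1, j2⟩]
  · rcases j1.halves with i | i
    exacts [⟨_, _, _, _, _, _, _, _, ‹_›, i1, i2, i, j2⟩, ⟨_, _, _, _, _, _, _, _, h, i1, i2, i, j2⟩]
  · rcases j2.halves with i | i
    exacts [⟨_, _, _, _, _, _, _, _, ‹_›, i1, i2, j1, i⟩, ⟨_, _, _, _, _, _, _, _, h, i1, i2, j1, i⟩]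

theorem Placed.gon_mem {x y ξ ζ : ℝ × ℝ} {τ : ℝ} (P : Placed c K x y τ ξ ζ) (k : Nat) :
    gon k ∈ K := P.disc _ (gon_mem_disc k)

/-- The vertex with a given code. -/
def vertex (c : Cell) (x y : ℝ × ℝ) (τ : ℝ) (ξ ζ : ℝ × ℝ) : Nat → ℝ × ℝ
  | 0 => (x.1 - 51200000, x.2 - 102400000)
  | 1 => (x.1 - 102400000, x.2 - 102400000)
  | 2 => (y.1 + (c.wx + (-τ * (c.wy - 25600000) + ξ.1)) - 102400000,
      y.2 + (c.wy + (τ * (c.wx - 25600000) + ξ.2)) - 102400000)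
  | 3 => (y.1 + (c.zx + (-τ * (c.zy - 25600000) + ζ.1)) - 102400000,
      y.2 + (c.zy + (τ * (c.zx - 25600000) + ζ.2)) - 102400000)
  | 4 => (y.1 + (51200000 - (c.wx + (-τ * (c.wy - 25600000) + ξ.1))) - 102400000,
      y.2 + (51200000 - (c.wy + (τ * (c.wx - 25600000) + ξ.2))) - 102400000)
  | 5 => (y.1 + (51200000 - (c.zx + (-τ * (c.zy - 25600000) + ζ.1))) - 102400000,
      y.2 + (51200000 - (c.zy + (τ * (c.zx - 25600000) + ζ.2))) - 102400000)
  | k + 6 => gon k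

theorem Placed.vertex_mem {x y ξ ζ : ℝ × ℝ} {τ : ℝ} (P : Placed c K x y τ ξ ζ) :
    ∀ k, vertex c x y τ ξ ζ k ∈ K
  | 0 => P.right
  | 1 => P.left
  | 2 => P.q1
  | 3 => P.q2
  | 4 => P.q3
  | 5 => P.q4
  | k + 6 => P.gon_mem k

theorem neg_abs_eq {a b A : ℝ} (h : |a| ≤ A) (e : b = -a) : |b| ≤ A := by rwa [e, abs_neg]

theorem Placed.rep_pt {x y ξ ζ : ℝ × ℝ} {τ : ℝ} (P : Placed c K x y τ ξ ζ)
    {a1 a2 b1 b2 h1 h2 k1 k2 : Nat} (i1 : Inside a1 h1 x.1) (i2 : Inside a2 h2 x.2)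
    (j1 : Inside b1 k1 y.1) (j2 : Inside b2 k2 y.2) (n : Nat) :
    let p := pt (segPt 0 (a1 + h1 + 51200000) (a2 + h2) h1 h2) (segPt 1 (a1 + h1) (a2 + h2) h1 h2)
      (rectPt 2 (b1 + k1) (b2 + k2) (k1 + c.rw) (k2 + c.rw) c.wx c.wy)
      (rectPt 3 (b1 + k1) (b2 + k2) (k1 + c.rw) (k2 + c.rw) c.zx c.zy)
      (rectPt 4 (b1 + k1) (b2 + k2) (k1 + c.rw) (k2 + c.rw) (51200000 - c.wx) (51200000 - c.wy))
      (rectPt 5 (b1 + k1) (b2 + k2) (k1 + c.rw) (k2 + c.rw) (51200000 - c.zx) (51200000 - c.zy))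
      n id
    Rep c ⟨(x.1 - (a1 + h1), x.2 - (a2 + h2)), (y.1 - (b1 + k1), y.2 - (b2 + k2)), τ⟩ p
      (vertex c x y τ ξ ζ p.code) := by
  match n with
  | 0 =>
    exact rep_segPt (by norm_num) (by simp [segPt, pt, pred6, vertex]; ring)
      (by simp [segPt, pt, pred6, vertex]) i1.abs_le i2.abs_le
  | 1 =>
    exact rep_segPt (by norm_num) (by simp [segPt, pt, pred6, vertex])
      (by simp [segPt, pt, pred6, vertex]) i1.abs_le i2.abs_le
  | 2 =>
    exact rep_rectPt (ξ := ξ) (by norm_num) (by simp [rectPt, pt, pred6, vertex])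
      (by simp [rectPt, pt, pred6, vertex]) j1.abs_le j2.abs_le P.ξ₁ P.ξ₂ P.w₁ P.w₂
  | 3 =>
    exact rep_rectPt (ξ := ζ) (by norm_num) (by simp [rectPt, pt, pred6, vertex])
      (by simp [rectPt, pt, pred6, vertex]) j1.abs_le j2.abs_le P.ζ₁ P.ζ₂ P.z₁ P.z₂
  | 4 =>
    have e1 := Nat.cast_sub (R := ℝ) P.wx
    have e2 := Nat.cast_sub (R := ℝ) P.wy
    refine rep_rectPt (ξ := -ξ) (by norm_num) ?_ ?_ j1.abs_le j2.abs_le (neg_abs_eq P.ξ₁ rfl)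
      (neg_abs_eq P.ξ₂ rfl) (neg_abs_eq P.w₁ ?_) (neg_abs_eq P.w₂ ?_)
    all_goals simp only [rectPt, pt, pred6, vertex, e1, e2, id, Prod.fst_neg, Prod.snd_neg]
    all_goals push_cast
    all_goals ring
  | 5 =>
    have e1 := Nat.cast_sub (R := ℝ) P.zx
    have e2 := Nat.cast_sub (R := ℝ) P.zy
    refine rep_rectPt (ξ := -ζ) (by norm_num) ?_ ?_ j1.abs_le j2.abs_le (neg_abs_eq P.ζ₁ rfl)
      (neg_abs_eq P.ζ₂ rfl) (neg_abs_eq P.z₁ ?_) (neg_abs_eq P.z₂ ?_)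
    all_goals simp only [rectPt, pt, pred6, vertex, e1, e2, id, Prod.fst_neg, Prod.snd_neg]
    all_goals push_cast
    all_goals ring
  | n + 6 =>
    intro p
    have e : p = gonPt n id := rfl
    have : vertex c x y τ ξ ζ p.code = gon n := by
      rw [e, gonPt_code, add_comm, ← gon_mod n]
      rfl
    rw [this]
    exact rep_gonPt n

/-- Induction on the depth: a successful box has a certified chain, and otherwise the actual
configuration lies in one of two boxes on which the search also succeeded. -/
theorem le_volume_of_search {x y ξ ζ : ℝ × ℝ} {τ : ℝ} (P : Placed c K x y τ ξ ζ) (n : Nat) :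
    ∀ {a1 a2 b1 b2 h1 h2 k1 k2 : Nat}, search c n a1 a2 b1 b2 h1 h2 k1 k2 = true →
      Inside a1 h1 x.1 → Inside a2 h2 x.2 → Inside b1 k1 y.1 → Inside b2 k2 y.2 →
      2097152000000000 ≤ 2 * volume.real K := by
  induction n with
  | zero => intro a1 a2 b1 b2 h1 h2 k1 k2 h; exact absurd h (by simp [search, loop])
  | succ n ih =>
    intro a1 a2 b1 b2 h1 h2 k1 k2 h i1 i2 j1 j2
    rw [search_succ, points_eq] at h
    have hrep := P.rep_pt i1 i2 j1 j2
    generalize segPt 0 (a1 + h1 + 51200000) (a2 + h2) h1 h2 = p0 at h hrep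
    generalize segPt 1 (a1 + h1) (a2 + h2) h1 h2 = p1 at h hrep
    generalize rectPt 2 (b1 + k1) (b2 + k2) (k1 + c.rw) (k2 + c.rw) c.wx c.wy = p2 at h hrep
    generalize rectPt 3 (b1 + k1) (b2 + k2) (k1 + c.rw) (k2 + c.rw) c.zx c.zy = p3 at h hrep
    generalize rectPt 4 (b1 + k1) (b2 + k2) (k1 + c.rw) (k2 + c.rw) (51200000 - c.wx)
      (51200000 - c.wy) = p4 at h hrep
    generalize rectPt 5 (b1 + k1) (b2 + k2) (k1 + c.rw) (k2 + c.rw) (51200000 - c.zx)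
      (51200000 - c.zy) = p5 at h hrep
    rw [forceL_eq _ _ (fun n => pt p0 p1 p2 p3 p4 p5 n id)
      (fun n k => pt_eq p0 p1 p2 p3 p4 p5 k n)] at h
    -- From here on the list of codes is arbitrary, so nothing about the gift wrapping needs proof.
    generalize chain p0 p1 p2 p3 p4 p5 = l at h
    cases l with
    | nil => exact absurd h (by simp [start, lrec])
    | cons a l =>
    have hl : ∀ w ∈ (a :: l).map (fun n => pt p0 p1 p2 p3 p4 p5 n id),
        Rep c ⟨(x.1 - (a1 + h1), x.2 - (a2 + h2)), (y.1 - (b1 + k1), y.2 - (b2 + k2)), τ⟩ w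
          (vertex c x y τ ξ ζ w.code) := by
      intro w hw
      obtain ⟨n, -, rfl⟩ := List.mem_map.1 hw
      exact hrep n
    rw [List.map_cons] at h hl
    generalize l.map _ = l at h hl
    generalize pt p0 p1 p2 p3 p4 p5 a id = v at h hl
    rw [start_cons, forceAcc_eq] at h
    have hv := hl v (by simp)
    have hl' : ∀ w ∈ l, Rep c _ w (vertex c x y τ ξ ζ w.code) := fun w hw => hl w (by simp [hw])
    have hb := bound_sums_le (z := fun p => vertex c x y τ ξ ζ p.code) i1.abs_le i2.abs_le
      j1.abs_le j2.abs_le hv l v ⟨0, 0, 0, 0, 0, 0, 0, 0, 0, 0, 0, 0, 0, 0, 0, 0⟩ hv hl'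
    -- The chain returns to `v`, so the two potentials in `hb` are equal and cancel.
    generalize sums v l v ⟨0, 0, 0, 0, 0, 0, 0, 0, 0, 0, 0, 0, 0, 0, 0, 0⟩ = s at h hb
    by_cases hs : slopes s h1 h2 k1 k2 (large c s (Nat.add h1 h2) (Nat.add k1 k2)) = true ∧
        edgesOk v l v = true ∧ anyRot 20 (v :: l) = true
    · obtain ⟨g1, g2, g3⟩ := hs
      have h4 := le_bound_of_large (σ := ⟨(x.1 - (a1 + h1), x.2 - (a2 + h2)),
        (y.1 - (b1 + k1), y.2 - (b2 + k2)), τ⟩) i1.abs_le i2.abs_le j1.abs_le j2.abs_le P.tau g1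
      have h0 : (0 : ℝ × ℝ) ∈ K := P.disc 0 (by norm_num)
      have h5 := isChain_of_edgesOk (z := fun p => vertex c x y τ ξ ζ p.code) P.convex P.finite h0
        P.gon_mem ⟨hv, P.vertex_mem _⟩ l v ⟨hv, P.vertex_mem _⟩
        (fun w hw => ⟨hl' w hw, P.vertex_mem _⟩) g2
      have h6 := pathSum_le_of_anyRot P.finite 20 v l hl h5 g3
      have h7 : Acc.bound c ⟨(x.1 - (a1 + h1), x.2 - (a2 + h2)),
        (y.1 - (b1 + k1), y.2 - (b2 + k2)), τ⟩ (h1 + h2) (k1 + k2)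
        ⟨0, 0, 0, 0, 0, 0, 0, 0, 0, 0, 0, 0, 0, 0, 0, 0⟩ = 0 := by simp [Acc.bound]
      linarith
    · have : ∃ e1 e2 f1 f2, split (search c n) a1 a2 b1 b2 h1 h2 k1 k2 e1 e2 f1 f2 = true := by
        simp only [slopes, strict_eq, both_eq, sel_eq, bisect, Bool.and_eq_true] at h hs
        rw [if_neg hs] at h
        exact ⟨_, _, _, _, h⟩
      obtain ⟨e1, e2, f1, f2, h⟩ := this
      obtain ⟨a1, a2, b1, b2, h1, h2, k1, k2, h, i1, i2, j1, j2⟩ := exists_of_split h i1 i2 j1 j2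
      exact ih h i1 i2 j1 j2

/-! ### Rotation of the rectangle within a cell of angles. -/

theorem cast_natDiv_le (a : Nat) {d : Nat} (hd : 0 < d) :
    ((Nat.div a d : ℕ) : ℝ) ≤ (a : ℝ) / d ∧ (a : ℝ) / d < (Nat.div a d : ℕ) + 1 := by
  have hd' : (0 : ℝ) < d := by exact_mod_cast hd
  rw [le_div_iff₀ hd', div_lt_iff₀ hd']
  have h1 := Nat.div_mul_le_self a d
  have h2 := Nat.lt_div_mul_add hd (a := a)
  constructor
  · exact_mod_cast h1
  · have : a < (a / d + 1) * d := by rw [add_mul, one_mul]; exact h2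
    exact_mod_cast this

theorem abs_le_of_sq_add_sq {x y r : ℝ} (hr : 0 ≤ r) (h : x ^ 2 + y ^ 2 ≤ r ^ 2) : |x| ≤ r :=
  abs_le_of_sq_le_sq (by nlinarith [sq_nonneg y]) hr

/-- The rotation by a small angle, of sine `τ` and cosine `κ`, of a point rounded to `w`. -/
theorem rotation_error {κ τ x y T : ℝ} {wx wy : ℕ} (h1 : κ ^ 2 + τ ^ 2 = 1) (hκ : 0 ≤ κ)
    (hτ : |τ| * 1000000 ≤ T) (hT : T ≤ 400000)
    (hr : x ^ 2 + y ^ 2 ≤ 18950000 ^ 2) (hx : wx ≤ x + 25600000) (hx' : x + 25600000 < wx + 1)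
    (hy : wy ≤ y + 25600000) (hy' : y + 25600000 < wy + 1) :
    |κ * x - τ * y - (wx - 25600000) + τ * (wy - 25600000)| ≤ T ^ 2 * 189500000 / 19000000000000 + 2
    ∧ |κ * y + τ * x - (wy - 25600000) - τ * (wx - 25600000)|
      ≤ T ^ 2 * 189500000 / 19000000000000 + 2 := by
  have hx1 := abs_le_of_sq_add_sq (by norm_num) hr
  have hy1 := abs_le_of_sq_add_sq (by norm_num) (add_comm (x ^ 2) _ ▸ hr)
  have ht : |τ| ≤ 0.4 := by linarith
  have hsq : τ ^ 2 * 1000000000000 ≤ T ^ 2 := by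
    have := pow_le_pow_left₀ (by positivity) hτ 2
    rw [mul_pow, sq_abs] at this
    linarith
  have ht2 : τ ^ 2 ≤ 0.16 := by
    have := pow_le_pow_left₀ (abs_nonneg τ) ht 2
    rw [sq_abs] at this
    linarith
  have hk9 : 0.9 ≤ κ := by nlinarith
  have hk1 : κ ≤ 1 := by nlinarith [sq_nonneg τ]
  -- Since `(1 - κ) * (1 + κ) = τ ^ 2` and `1 + κ ≥ 1.9`. This is the source of the factor 189500000
  -- / 19000000000000, where 18950000 exceeds half the scaled diagonal.
  have hk : 1.9 * (1 - κ) ≤ τ ^ 2 := by nlinarith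
  have aux : ∀ {a e f : ℝ}, |a| ≤ 18950000 → |e| ≤ 1 → |f| ≤ 1 →
      |-((1 - κ) * a) + e + τ * f| ≤ T ^ 2 * 189500000 / 19000000000000 + 2 := by
    intro a e f ha he hf
    have i1 : |-((1 - κ) * a)| ≤ (1 - κ) * 18950000 := by
      rw [abs_neg, abs_mul, abs_of_nonneg (by linarith : 0 ≤ 1 - κ)]
      gcongr
    have i2 : |τ * f| ≤ 0.4 * 1 := by rw [abs_mul]; gcongr
    have i3 := abs_add_le (-((1 - κ) * a) + e) (τ * f)
    have i4 := abs_add_le (-((1 - κ) * a)) e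
    linarith
  constructor
  · have := aux hx1 (e := x - (wx - 25600000)) (f := -(y - (wy - 25600000)))
      (by rw [abs_le]; constructor <;> linarith) (by rw [abs_neg, abs_le]; constructor <;> linarith)
    convert this using 2; ring
  · have := aux hy1 (e := y - (wy - 25600000)) (f := x - (wx - 25600000))
      (by rw [abs_le]; constructor <;> linarith) (by rw [abs_le]; constructor <;> linarith)
    convert this using 2; ring

theorem turn_error {τ T a e : ℝ} {w : ℕ} (hτ : |τ| * 1000000 ≤ T) (hT : T ≤ 400000)
    (ha : |a| ≤ 18950000) (hw : w ≤ a + 25600000) (hw' : a + 25600000 < w + 1)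
    (he : |e| ≤ T ^ 2 * 189500000 / 19000000000000 + 2) :
    |τ * (w - 25600000) + e| ≤ T ^ 2 * 189500000 / 19000000000000 + 3 + T * 18950000 / 1000000 := by
  have i1 := abs_add_le (τ * (w - 25600000)) e
  have i2 : |(w : ℝ) - 25600000| ≤ 18950001 := by
    rw [abs_le] at ha ⊢
    constructor <;> linarith
  have i3 : |τ * (w - 25600000)| ≤ |τ| * 18950001 := by rw [abs_mul]; gcongr
  linarith

/-- The rectangle rotated by the angle in the middle of the cell `[n₀ / 64, n₁ / 64]`. -/
def cell (n0 n1 : Nat) : Cell :=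
  let m := n0 + n1
  let d := 16384 + m * m
  let e := 16384 - m * m
  let tau := Nat.succ (Nat.div ((n1 - n0) * 64000000) (4096 + n0 * n0))
  let xi := 3 + Nat.div (tau * tau * 189500000) 19000000000000
  { wx := Nat.div (25600000 * d + 16757760 * e - 8842240 * (256 * m)) d
    wy := Nat.div (25600000 * d + 8842240 * e + 16757760 * (256 * m)) d
    zx := Nat.div (25600000 * d + 16757760 * e + 8842240 * (256 * m)) d
    zy := Nat.div (25600000 * d + 16757760 * (256 * m) - 8842240 * e) d
    tau := tau
    xi := xi
    rw := xi + 2 + Nat.div (tau * 18950000) 1000000 }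

theorem cell_tau (n0 n1 : Nat) : (cell n0 n1).tau
    = Nat.div ((n1 - n0) * 64000000) (4096 + n0 * n0) + 1 := rfl

theorem cell_xi (n0 n1 : Nat) : (cell n0 n1).xi
    = 3 + Nat.div ((cell n0 n1).tau * (cell n0 n1).tau * 189500000) 19000000000000 := rfl

theorem cell_rw (n0 n1 : Nat) : (cell n0 n1).rw
    = (cell n0 n1).xi + 2 + Nat.div ((cell n0 n1).tau * 18950000) 1000000 := rfl

theorem mkCell_eq (n0 n1 : Nat) (k : Cell → Bool) : mkCell n0 n1 k = k (cell n0 n1) := by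
  simp only [mkCell, strict_eq]
  rfl

/-- The left side is the absolute sine of the difference of two angles with half-angle tangents `t`
and `tm`. It factors through `t - tm`, and the remaining quotient is largest at the lower end `t0`.
-/
theorem sin_sub_le {t tm t0 d : ℝ} (h0 : 0 ≤ t0) (ht : t0 ≤ t) (hm : t0 ≤ tm)
    (hd : |t - tm| ≤ d) :
    |2 * t / (1 + t ^ 2) * ((1 - tm ^ 2) / (1 + tm ^ 2))
      - (1 - t ^ 2) / (1 + t ^ 2) * (2 * tm / (1 + tm ^ 2))| ≤ 2 * d / (1 + t0 ^ 2) := by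
  have hp : 0 < (1 + t ^ 2) * (1 + tm ^ 2) := by positivity
  have e : 2 * t / (1 + t ^ 2) * ((1 - tm ^ 2) / (1 + tm ^ 2))
      - (1 - t ^ 2) / (1 + t ^ 2) * (2 * tm / (1 + tm ^ 2))
      = 2 * (t - tm) * (1 + t * tm) / ((1 + t ^ 2) * (1 + tm ^ 2)) := by
    field_simp; ring
  have hq : (1 + t * tm) * (1 + t0 ^ 2) ≤ (1 + t ^ 2) * (1 + tm ^ 2) := by
    have ht' := h0.trans ht
    have hm' := h0.trans hm
    rcases le_total t tm with h | h
    · have i1 : 1 + t * tm ≤ 1 + tm ^ 2 := by nlinarith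
      have i2 : 1 + t0 ^ 2 ≤ 1 + t ^ 2 := by nlinarith
      rw [mul_comm (1 + t ^ 2)]
      gcongr
    · have i1 : 1 + t * tm ≤ 1 + t ^ 2 := by nlinarith
      have i2 : 1 + t0 ^ 2 ≤ 1 + tm ^ 2 := by nlinarith
      gcongr
  rw [e, abs_div, abs_mul, abs_mul, abs_of_pos hp, abs_two,
    abs_of_nonneg (by have := mul_nonneg (h0.trans ht) (h0.trans hm); linarith : 0 ≤ 1 + t * tm),
    div_le_div_iff₀ hp (by positivity)]
  have hd0 := (abs_nonneg _).trans hd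
  have htt := mul_nonneg (h0.trans ht) (h0.trans hm)
  calc 2 * |t - tm| * (1 + t * tm) * (1 + t0 ^ 2) = 2 * |t - tm| * ((1 + t * tm) * (1 + t0 ^ 2)) := by
        ring
    _ ≤ 2 * d * ((1 + t ^ 2) * (1 + tm ^ 2)) := by gcongr

set_option maxHeartbeats 400000 in
theorem exists_placed {K : Set (ℝ × ℝ)} {n0 n1 : Nat} (hn : n0 ≤ n1) (hn' : n1 ≤ 64)
    (hT : (cell n0 n1).tau ≤ 400000) {t : ℝ} (ht0 : (n0 : ℝ) / 64 ≤ t) (ht1 : t ≤ (n1 : ℝ) / 64)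
    {X Y : ℝ × ℝ} {c s : ℝ} (hcs : c = (1 - t ^ 2) / (1 + t ^ 2)) (hs : s = 2 * t / (1 + t ^ 2))
    (hconv : Convex ℝ K) (hfin : volume K ≠ ⊤)
    (disc : ∀ p : ℝ × ℝ, p.1 ^ 2 + p.2 ^ 2 ≤ 265607202451600 → p ∈ K)
    (right : (X.1 + 25600000, X.2) ∈ K) (left : (X.1 - 25600000, X.2) ∈ K)
    (q1 : (Y.1 + (16757760 * c - 8842240 * s), Y.2 + (8842240 * c + 16757760 * s)) ∈ K)
    (q2 : (Y.1 + (16757760 * c + 8842240 * s), Y.2 + (-8842240 * c + 16757760 * s)) ∈ K)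
    (q3 : (Y.1 - (16757760 * c - 8842240 * s), Y.2 - (8842240 * c + 16757760 * s)) ∈ K)
    (q4 : (Y.1 - (16757760 * c + 8842240 * s), Y.2 - (-8842240 * c + 16757760 * s)) ∈ K) :
    ∃ τ ξ ζ, Placed (cell n0 n1) K (X.1 + 76800000, X.2 + 102400000)
      (Y.1 + 76800000, Y.2 + 76800000) τ ξ ζ := by
  set m : ℕ := n0 + n1 with hm
  have hm128 : m ≤ 128 := by omega
  set d : ℕ := 16384 + m * m with hd
  set e : ℕ := 16384 - m * m with he
  have hmm : m * m ≤ 16384 := Nat.mul_le_mul hm128 hm128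
  have he' : (e : ℝ) = 16384 - m * m := by rw [he, Nat.cast_sub hmm]; push_cast; ring
  have hd' : (d : ℝ) = 16384 + m * m := by rw [hd]; push_cast; ring
  have hdpos : 0 < d := by omega
  have hdpos' : (0 : ℝ) < d := by exact_mod_cast hdpos
  set tm : ℝ := m / 128 with htm
  set cm : ℝ := (1 - tm ^ 2) / (1 + tm ^ 2) with hcm
  set sm : ℝ := 2 * tm / (1 + tm ^ 2) with hsm
  have hcm' : (e : ℝ) / d = cm := by
    rw [hcm, he', hd', htm]
    have : (16384 + m * m : ℝ) ≠ 0 := by positivity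
    field_simp
    ring
  have hsm' : (256 * m : ℝ) / d = sm := by
    rw [hsm, hd', htm]
    have : (16384 + m * m : ℝ) ≠ 0 := by positivity
    field_simp
    ring
  have hcs1 : c ^ 2 + s ^ 2 = 1 := by rw [hcs, hs]; field_simp; ring
  have hcsm1 : cm ^ 2 + sm ^ 2 = 1 := by rw [hcm, hsm]; field_simp; ring
  -- `κ` and `τ` are the cosine and sine of the deviation from the middle angle of the cell.
  set κ := c * cm + s * sm
  set τ := s * cm - c * sm with hτ
  have hκτ : κ ^ 2 + τ ^ 2 = 1 := by
    calc κ ^ 2 + τ ^ 2 = (c ^ 2 + s ^ 2) * (cm ^ 2 + sm ^ 2) := by ring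
      _ = 1 := by rw [hcs1, hcsm1, one_mul]
  have hc' : c = κ * cm - τ * sm := by
    calc c = c * (cm ^ 2 + sm ^ 2) := by rw [hcsm1, mul_one]
      _ = _ := by ring
  have hs' : s = κ * sm + τ * cm := by
    calc s = s * (cm ^ 2 + sm ^ 2) := by rw [hcsm1, mul_one]
      _ = _ := by ring
  have ht0' : 0 ≤ (n0 : ℝ) / 64 := by positivity
  have htpos : 0 ≤ t := ht0'.trans ht0
  have hn1 : (n1 : ℝ) ≤ 64 := by exact_mod_cast hn'
  have hn01 : (n0 : ℝ) ≤ n1 := by exact_mod_cast hn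
  have ht1' : t ≤ 1 := by linarith
  have htm' : tm = (n0 + n1) / 128 := by rw [htm, hm]; push_cast; ring
  have htm0 : 0 ≤ tm := by positivity
  have htm1 : tm ≤ 1 := by rw [htm']; linarith
  have hκ : 0 ≤ κ := by
    have i1 : 0 ≤ c := by
      rw [hcs]; exact div_nonneg (sub_nonneg.2 (pow_le_one₀ htpos ht1')) (by positivity)
    have i2 : 0 ≤ s := by rw [hs]; positivity
    have i3 : 0 ≤ cm := div_nonneg (sub_nonneg.2 (pow_le_one₀ htm0 htm1)) (by positivity)
    have i4 : 0 ≤ sm := by positivity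
    positivity
  set T : ℕ := (cell n0 n1).tau with hTdef
  have hTT : |τ| * 1000000 ≤ T := by
    have h1 := sin_sub_le (d := (n1 - n0) / 128) ht0' ht0 (tm := tm) (by rw [htm']; linarith)
      (by rw [abs_le, htm']; constructor <;> linarith)
    rw [← hs, ← hcs, ← hcm, ← hsm, ← hτ] at h1
    have h2 := (cast_natDiv_le ((n1 - n0) * 64000000) (d := 4096 + n0 * n0) (by omega)).2
    have h3 : (T : ℝ) = (Nat.div ((n1 - n0) * 64000000) (4096 + n0 * n0) : ℕ) + 1 := by
      rw [hTdef, cell_tau]; push_cast; rfl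
    rw [h3]
    refine le_trans ?_ h2.le
    rw [Nat.cast_mul, Nat.cast_sub hn]
    push_cast
    calc |τ| * 1000000 ≤ 2 * ((n1 - n0) / 128) / (1 + ((n0 : ℝ) / 64) ^ 2) * 1000000 := by gcongr
      _ = _ := by field_simp; ring
  have hT' : (T : ℝ) ≤ 400000 := by exact_mod_cast hT
  have hxi : (T : ℝ) ^ 2 * 189500000 / 19000000000000 + 2 ≤ (cell n0 n1).xi := by
    have h2 := (cast_natDiv_le (T * T * 189500000) (d := 19000000000000) (by omega)).2
    have h3 : ((cell n0 n1).xi : ℝ) = 3 + (Nat.div (T * T * 189500000) 19000000000000 : ℕ) := by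
      rw [hTdef, cell_xi]; push_cast; rfl
    rw [h3]
    push_cast at h2
    rw [sq]
    linarith
  have hrw : (T : ℝ) ^ 2 * 189500000 / 19000000000000 + 3 + T * 18950000 / 1000000
      ≤ (cell n0 n1).rw := by
    have h2 := (cast_natDiv_le (T * 18950000) (d := 1000000) (by omega)).2
    have h3 : ((cell n0 n1).rw : ℝ) = (cell n0 n1).xi + 2
        + (Nat.div (T * 18950000) 1000000 : ℕ) := by
      rw [hTdef, cell_rw]; push_cast; rfl
    rw [h3]
    push_cast at h2
    linarith
  -- This is `(m - 128) ^ 2 ≥ 0`; together with `hed` it ensures that the truncated subtractions in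
  -- `wx` and `zy` are exact.
  have hme : 256 * m ≤ d := by
    have : (256 * m : ℤ) ≤ 16384 + m * m := by linarith [sq_nonneg ((m : ℤ) - 128), sub_sq (m : ℤ) 128]
    exact_mod_cast this
  have hed : e ≤ d := by omega
  have floor : ∀ (a : ℕ) (v : ℝ), (a : ℝ) / d = v → ((Nat.div a d : ℕ) : ℝ) ≤ v ∧
      v < (Nat.div a d : ℕ) + 1 := by
    intro a v h
    rw [← h]
    exact cast_natDiv_le a hdpos
  have hwx := floor (25600000 * d + 16757760 * e - 8842240 * (256 * m))
    (16757760 * cm - 8842240 * sm + 25600000) (by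
      rw [Nat.cast_sub (by omega), ← hcm', ← hsm']; push_cast; field_simp; ring)
  have hwy := floor (25600000 * d + 8842240 * e + 16757760 * (256 * m))
    (8842240 * cm + 16757760 * sm + 25600000) (by
      rw [← hcm', ← hsm']; push_cast; field_simp; ring)
  have hzx := floor (25600000 * d + 16757760 * e + 8842240 * (256 * m))
    (16757760 * cm + 8842240 * sm + 25600000) (by
      rw [← hcm', ← hsm']; push_cast; field_simp; ring)
  have hzy := floor (25600000 * d + 16757760 * (256 * m) - 8842240 * e)
    (-8842240 * cm + 16757760 * sm + 25600000) (by
      rw [Nat.cast_sub (by omega), ← hcm', ← hsm']; push_cast; field_simp; ring)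
  change (((cell n0 n1).wx : ℕ) : ℝ) ≤ _ ∧ _ < (((cell n0 n1).wx : ℕ) : ℝ) + 1 at hwx
  change (((cell n0 n1).wy : ℕ) : ℝ) ≤ _ ∧ _ < (((cell n0 n1).wy : ℕ) : ℝ) + 1 at hwy
  change (((cell n0 n1).zx : ℕ) : ℝ) ≤ _ ∧ _ < (((cell n0 n1).zx : ℕ) : ℝ) + 1 at hzx
  change (((cell n0 n1).zy : ℕ) : ℝ) ≤ _ ∧ _ < (((cell n0 n1).zy : ℕ) : ℝ) + 1 at hzy
  have hnw : (16757760 * cm - 8842240 * sm) ^ 2 + (8842240 * cm + 16757760 * sm) ^ 2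
      ≤ (18950000 : ℝ) ^ 2 := by
    calc _ = (16757760 ^ 2 + 8842240 ^ 2) * (cm ^ 2 + sm ^ 2) := by ring
      _ ≤ _ := by rw [hcsm1]; norm_num
  have hnz : (16757760 * cm + 8842240 * sm) ^ 2 + (-8842240 * cm + 16757760 * sm) ^ 2
      ≤ (18950000 : ℝ) ^ 2 := by
    calc _ = (16757760 ^ 2 + 8842240 ^ 2) * (cm ^ 2 + sm ^ 2) := by ring
      _ ≤ _ := by rw [hcsm1]; norm_num
  have awx := abs_le_of_sq_add_sq (by norm_num) hnw
  have awy := abs_le_of_sq_add_sq (by norm_num) (add_comm ((16757760 * cm - 8842240 * sm) ^ 2) _ ▸ hnw)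
  have azx := abs_le_of_sq_add_sq (by norm_num) hnz
  have azy := abs_le_of_sq_add_sq (by norm_num) (add_comm ((16757760 * cm + 8842240 * sm) ^ 2) _ ▸ hnz)
  have fits : ∀ {w : ℕ} {a : ℝ}, |a| ≤ 18950000 → (w : ℝ) ≤ a + 25600000 → w ≤ 51200000 := by
    intro w a h1 h2
    have : (w : ℝ) ≤ (51200000 : ℕ) := by push_cast; linarith [le_of_abs_le h1]
    exact_mod_cast this
  obtain ⟨ew1, ew2⟩ := rotation_error hκτ hκ hTT hT' hnw hwx.1 hwx.2 hwy.1 hwy.2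
  obtain ⟨ez1, ez2⟩ := rotation_error hκτ hκ hTT hT' hnz hzx.1 hzx.2 hzy.1 hzy.2
  have hTn : |-τ| * 1000000 ≤ T := by rwa [abs_neg]
  -- The two anonymous pairs are the residuals bounded in `ew1`, `ew2`, `ez1` and `ez2`.
  refine ⟨τ, (_, _), (_, _), ⟨hconv, hfin, disc, ?_, ?_, ?_, ?_, ?_, ?_, fits awx hwx.1,
    fits awy hwy.1, fits azx hzx.1, fits azy hzy.1, hTT, ew1.trans hxi, ew2.trans hxi,
    ez1.trans hxi, ez2.trans hxi, (turn_error hTn hT' awy hwy.1 hwy.2 ew1).trans hrw,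
    (turn_error hTT hT' awx hwx.1 hwx.2 ew2).trans hrw,
    (turn_error hTn hT' azy hzy.1 hzy.2 ez1).trans hrw,
    (turn_error hTT hT' azx hzx.1 hzx.2 ez2).trans hrw⟩⟩
  · convert right using 2 <;> ring
  · convert left using 2 <;> ring
  · convert q1 using 2 <;> rw [hc', hs'] <;> ring
  · convert q2 using 2 <;> rw [hc', hs'] <;> ring
  · convert q3 using 2 <;> rw [hc', hs'] <;> ring
  · convert q4 using 2 <;> rw [hc', hs'] <;> ring

/-! ### Kernel evaluation of the cells and their union. -/

theorem cellOk_0_2 : cellOk 0 2 = true := by decide +kernel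

theorem cellOk_2_4 : cellOk 2 4 = true := by decide +kernel

theorem cellOk_4_5 : cellOk 4 5 = true := by decide +kernel

theorem cellOk_5_6 : cellOk 5 6 = true := by decide +kernel

theorem cellOk_6_7 : cellOk 6 7 = true := by decide +kernel

theorem cellOk_7_8 : cellOk 7 8 = true := by decide +kernel

theorem cellOk_8_10 : cellOk 8 10 = true := by decide +kernel

theorem cellOk_10_12 : cellOk 10 12 = true := by decide +kernel

theorem cellOk_12_15 : cellOk 12 15 = true := by decide +kernel

theorem cellOk_15_18 : cellOk 15 18 = true := by decide +kernel

theorem cellOk_18_21 : cellOk 18 21 = true := by decide +kernel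

theorem cellOk_21_24 : cellOk 21 24 = true := by decide +kernel

theorem cellOk_24_26 : cellOk 24 26 = true := by decide +kernel

theorem cellOk_26_28 : cellOk 26 28 = true := by decide +kernel

theorem cellOk_28_29 : cellOk 28 29 = true := by decide +kernel

theorem cellOk_29_30 : cellOk 29 30 = true := by decide +kernel

theorem cellOk_30_32 : cellOk 30 32 = true := by decide +kernel

theorem cellOk_32_35 : cellOk 32 35 = true := by decide +kernel

theorem cellOk_35_39 : cellOk 35 39 = true := by decide +kernel

theorem cellOk_39_43 : cellOk 39 43 = true := by decide +kernel

theorem cellOk_43_47 : cellOk 43 47 = true := by decide +kernel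

theorem cellOk_47_55 : cellOk 47 55 = true := by decide +kernel

theorem cellOk_55_64 : cellOk 55 64 = true := by decide +kernel

/-- Every parameter in `[a / 64, b / 64]` belongs to a cell that has been searched. -/
def Covered (a b : Nat) : Prop := ∀ t : ℝ, (a : ℝ) / 64 ≤ t → t ≤ (b : ℝ) / 64 →
  ∃ n0 n1 : Nat, n0 ≤ n1 ∧ n1 ≤ 64 ∧ (cell n0 n1).tau ≤ 400000 ∧ cellOk n0 n1 = true ∧
    (n0 : ℝ) / 64 ≤ t ∧ t ≤ (n1 : ℝ) / 64

theorem Covered.trans {a b d : Nat} (h : Covered a b) (h' : Covered b d) : Covered a d := by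
  intro t h1 h2
  rcases le_total t ((b : ℝ) / 64) with h3 | h3
  exacts [h t h1 h3, h' t h3 h2]

theorem covered_of_cellOk {a b : Nat} (h : cellOk a b = true) (h1 : a ≤ b) (h2 : b ≤ 64)
    (h3 : (cell a b).tau ≤ 400000) : Covered a b :=
  fun _ i j => ⟨a, b, h1, h2, h3, h, i, j⟩

theorem covered_zero_one : Covered 0 64 := by
  refine Covered.trans
    (covered_of_cellOk cellOk_0_2 (by decide) (by decide) (by decide +kernel)) ?_
  refine Covered.trans
    (covered_of_cellOk cellOk_2_4 (by decide) (by decide) (by decide +kernel)) ?_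
  refine Covered.trans
    (covered_of_cellOk cellOk_4_5 (by decide) (by decide) (by decide +kernel)) ?_
  refine Covered.trans
    (covered_of_cellOk cellOk_5_6 (by decide) (by decide) (by decide +kernel)) ?_
  refine Covered.trans
    (covered_of_cellOk cellOk_6_7 (by decide) (by decide) (by decide +kernel)) ?_
  refine Covered.trans
    (covered_of_cellOk cellOk_7_8 (by decide) (by decide) (by decide +kernel)) ?_
  refine Covered.trans
    (covered_of_cellOk cellOk_8_10 (by decide) (by decide) (by decide +kernel)) ?_
  refine Covered.trans
    (covered_of_cellOk cellOk_10_12 (by decide) (by decide) (by decide +kernel)) ?_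
  refine Covered.trans
    (covered_of_cellOk cellOk_12_15 (by decide) (by decide) (by decide +kernel)) ?_
  refine Covered.trans
    (covered_of_cellOk cellOk_15_18 (by decide) (by decide) (by decide +kernel)) ?_
  refine Covered.trans
    (covered_of_cellOk cellOk_18_21 (by decide) (by decide) (by decide +kernel)) ?_
  refine Covered.trans
    (covered_of_cellOk cellOk_21_24 (by decide) (by decide) (by decide +kernel)) ?_
  refine Covered.trans
    (covered_of_cellOk cellOk_24_26 (by decide) (by decide) (by decide +kernel)) ?_
  refine Covered.trans
    (covered_of_cellOk cellOk_26_28 (by decide) (by decide) (by decide +kernel)) ?_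
  refine Covered.trans
    (covered_of_cellOk cellOk_28_29 (by decide) (by decide) (by decide +kernel)) ?_
  refine Covered.trans
    (covered_of_cellOk cellOk_29_30 (by decide) (by decide) (by decide +kernel)) ?_
  refine Covered.trans
    (covered_of_cellOk cellOk_30_32 (by decide) (by decide) (by decide +kernel)) ?_
  refine Covered.trans
    (covered_of_cellOk cellOk_32_35 (by decide) (by decide) (by decide +kernel)) ?_
  refine Covered.trans
    (covered_of_cellOk cellOk_35_39 (by decide) (by decide) (by decide +kernel)) ?_
  refine Covered.trans
    (covered_of_cellOk cellOk_39_43 (by decide) (by decide) (by decide +kernel)) ?_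
  refine Covered.trans
    (covered_of_cellOk cellOk_43_47 (by decide) (by decide) (by decide +kernel)) ?_
  refine Covered.trans
    (covered_of_cellOk cellOk_47_55 (by decide) (by decide) (by decide +kernel)) ?_
  exact covered_of_cellOk cellOk_55_64 (by decide) (by decide) (by decide +kernel)

theorem cellOk_eq (n0 n1 : Nat) : cellOk n0 n1 = search (cell n0 n1) 50 76800000 61440000 32000000
    32000000 20480000 40960000 44800000 44800000 := mkCell_eq n0 n1 _

end Search

/-! ### Reduction by symmetry to a compact set of configurations. -/

/-- Lengths are scaled by `102400000`. The convex set `K` contains the disc of perimeter `1` around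
the origin, the horizontal segment of length `1 / 2` with midpoint `X`, and the vertices of the
rectangle with centre `Y` whose longer side has the direction `(c, s)`. -/
structure Contains (K : Set (ℝ × ℝ)) (X Y : ℝ × ℝ) (c s : ℝ) : Prop where
  convex : Convex ℝ K
  finite : volume K ≠ ⊤
  unit : c ^ 2 + s ^ 2 = 1
  disc : ∀ p : ℝ × ℝ, p.1 ^ 2 + p.2 ^ 2 ≤ 265607202451600 → p ∈ K
  right : (X.1 + 25600000, X.2) ∈ K
  left : (X.1 - 25600000, X.2) ∈ K
  q1 : (Y.1 + (16757760 * c - 8842240 * s), Y.2 + (8842240 * c + 16757760 * s)) ∈ K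
  q2 : (Y.1 + (16757760 * c + 8842240 * s), Y.2 + (-8842240 * c + 16757760 * s)) ∈ K
  q3 : (Y.1 - (16757760 * c - 8842240 * s), Y.2 - (8842240 * c + 16757760 * s)) ∈ K
  q4 : (Y.1 - (16757760 * c + 8842240 * s), Y.2 - (-8842240 * c + 16757760 * s)) ∈ K

variable {K : Set (ℝ × ℝ)} {X Y : ℝ × ℝ} {c s : ℝ}

/-- The area of the convex hull of a disc and a point far from its centre. -/
theorem le_volume_of_far_point (hc : Convex ℝ K) (hK : volume K ≠ ⊤)
    (disc : ∀ p : ℝ × ℝ, p.1 ^ 2 + p.2 ^ 2 ≤ 265607202451600 → p ∈ K) {V : ℝ × ℝ} (hV : V ∈ K)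
    (hfar : 48128000 ^ 2 ≤ V.1 ^ 2 + V.2 ^ 2) : 1048576000000000 ≤ volume.real K := by
  set l := √(V.1 ^ 2 + V.2 ^ 2)
  have hl : 48128000 ≤ l := Real.le_sqrt_of_sq_le hfar
  have hl2 : V.1 ^ 2 + V.2 ^ 2 = l ^ 2 := (Real.sq_sqrt (by positivity)).symm
  have hl0 : 0 < l := by linarith
  set a := V.1 / l
  set b := V.2 / l
  have ha : V.1 = l * a := by simp only [a]; field_simp
  have hb : V.2 = l * b := by simp only [b]; field_simp
  have hab : a ^ 2 + b ^ 2 = 1 := by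
    simp only [a, b]; rw [div_pow, div_pow, ← add_div, hl2]; field_simp
  have hVab : V = (l * a, l * b) := Prod.ext ha hb
  have h0 : (0 : ℝ × ℝ) ∈ K := disc 0 (by norm_num)
  have hU : ((-16297460 * b, 16297460 * a) : ℝ × ℝ) ∈ K := by apply disc; simp only; nlinarith
  have hW : ((-16297460 * a, -16297460 * b) : ℝ × ℝ) ∈ K := by apply disc; simp only; nlinarith
  have hU' : ((16297460 * b, -16297460 * a) : ℝ × ℝ) ∈ K := by apply disc; simp only; nlinarith
  rw [hVab] at hV
  have e1 : cross (l * a, l * b) (-16297460 * b, 16297460 * a) = 16297460 * l := by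
    calc _ = 16297460 * l * (a ^ 2 + b ^ 2) := by simp only [cross]; ring
      _ = _ := by rw [hab, mul_one]
  have e2 : cross (-16297460 * b, 16297460 * a) (-16297460 * a, -16297460 * b)
      = 16297460 * 16297460 := by
    calc _ = 16297460 * 16297460 * (a ^ 2 + b ^ 2) := by simp only [cross]; ring
      _ = _ := by rw [hab, mul_one]
  have e3 : cross (-16297460 * a, -16297460 * b) (16297460 * b, -16297460 * a)
      = 16297460 * 16297460 := by
    calc _ = 16297460 * 16297460 * (a ^ 2 + b ^ 2) := by simp only [cross]; ring
      _ = _ := by rw [hab, mul_one]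
  have e4 : cross (16297460 * b, -16297460 * a) (l * a, l * b) = 16297460 * l := by
    calc _ = 16297460 * l * (a ^ 2 + b ^ 2) := by simp only [cross]; ring
      _ = _ := by rw [hab, mul_one]
  have edge : ∀ {u w : ℝ × ℝ}, u ∈ K → w ∈ K → 0 < cross u w → Edge K id cross u w :=
    fun hu hw h => ⟨h, cross_le_sector hc hK h0 hu hw⟩
  -- The chain is a kite: `V`, the two disc points perpendicular to it, and the disc point opposite.
  -- Its area is `16297460 * (l + 16297460)`. The opposite point has zero cross product with `V` and
  -- is the vertex whose sign `Turns` leaves free.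
  have := pathSum_closed_le (z := id) (ω := cross) hK (l * a, l * b)
    [(-16297460 * b, 16297460 * a), (-16297460 * a, -16297460 * b), (16297460 * b, -16297460 * a)]
    (by
      simp only [List.cons_append, List.nil_append, List.isChain_cons_cons,
        List.isChain_singleton, and_true]
      exact ⟨edge hV hU (by rw [e1]; positivity), edge hU hW (by rw [e2]; positivity),
        edge hW hU' (by rw [e3]; positivity), edge hU' hV (by rw [e4]; positivity)⟩)
    (Or.inl ⟨by simp only [id]; rw [e1]; positivity, Or.inr (by
      simp only [List.mem_singleton, forall_eq, id]
      rw [e4]; positivity)⟩)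
  simp only [List.cons_append, List.nil_append, pathSum, e1, e2, e3, e4] at this
  linarith

/-- The half-angle tangent is `s / (1 + c)`. It makes cosine and sine rational in `t`, so cells with
rational end points can be treated in integer arithmetic. -/
theorem exists_tan_half (h : c ^ 2 + s ^ 2 = 1) (hc : 0 ≤ c) (hs : 0 ≤ s) :
    ∃ t : ℝ, 0 ≤ t ∧ t ≤ 1 ∧ c = (1 - t ^ 2) / (1 + t ^ 2) ∧ s = 2 * t / (1 + t ^ 2) := by
  have hc1 : 0 < 1 + c := by linarith
  obtain ⟨t, ht⟩ : ∃ t, t = s / (1 + c) := ⟨_, rfl⟩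
  have hst : s = t * (1 + c) := by rw [ht]; field_simp
  have hc' : c * (1 + t ^ 2) = 1 - t ^ 2 := by
    have : (1 + c) * (c * (1 + t ^ 2)) = (1 + c) * (1 - t ^ 2) := by
      rw [hst] at h
      linear_combination h
    exact mul_left_cancel₀ hc1.ne' this
  have hs1 : s ≤ 1 := by nlinarith [sq_nonneg c]
  refine ⟨t, by rw [ht]; positivity, by rw [ht, div_le_one hc1]; linarith, ?_, ?_⟩
  · rw [eq_div_iff (by positivity)]; exact hc'
  · rw [eq_div_iff (by positivity)]
    linear_combination (1 + t ^ 2) * hst + t * hc'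

theorem Contains.le_volume_of_nonneg (h : Contains K X Y c s) (hc : 0 ≤ c) (hs : 0 ≤ s)
    (hX : 0 ≤ X.1) : 1048576000000000 ≤ volume.real K := by
  by_contra! hlt
  have near : ∀ p ∈ K, p.1 ^ 2 + p.2 ^ 2 < 48128000 ^ 2 := by
    intro p hp
    by_contra! hp'
    exact absurd (le_volume_of_far_point h.convex h.finite h.disc hp hp') (not_le.2 hlt)
  have n1 := near _ h.right
  have n2 := near _ h.left
  have m1 := near _ h.q1
  have m3 := near _ h.q3
  simp only at n1 n2 m1 m3
  -- By the parallelogram law, averaging the bounds at the two ends gives `|X|² < 48128000² -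
  -- 25600000²`. Opposite corners of the rectangle give the bound on `Y` in the same way.
  have hX2 : X.1 ^ 2 + X.2 ^ 2 ≤ 40960000 ^ 2 := by linarith
  have hY2 : Y.1 ^ 2 + Y.2 ^ 2 ≤ 44800000 ^ 2 := by
    have e : (16757760 * c - 8842240 * s) ^ 2 + (8842240 * c + 16757760 * s) ^ 2
        = 16757760 ^ 2 + 8842240 ^ 2 := by
      calc _ = (16757760 ^ 2 + 8842240 ^ 2) * (c ^ 2 + s ^ 2) := by ring
        _ = _ := by rw [h.unit, mul_one]
    linarith
  have x1 := abs_le.1 (Search.abs_le_of_sq_add_sq (by norm_num) hX2)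
  have x2 := abs_le.1 (Search.abs_le_of_sq_add_sq (by norm_num) (add_comm (X.1 ^ 2) _ ▸ hX2))
  have y1 := abs_le.1 (Search.abs_le_of_sq_add_sq (by norm_num) hY2)
  have y2 := abs_le.1 (Search.abs_le_of_sq_add_sq (by norm_num) (add_comm (Y.1 ^ 2) _ ▸ hY2))
  obtain ⟨t, ht0, ht1, ec, es⟩ := exists_tan_half h.unit hc hs
  obtain ⟨n0, n1, hn, hn', hT, hok, i, j⟩ := Search.covered_zero_one t (by simpa using ht0)
    (by norm_num; exact ht1)
  obtain ⟨τ, ξ, ζ, P⟩ := Search.exists_placed hn hn' hT i j ec es h.convex h.finite h.disc h.right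
    h.left h.q1 h.q2 h.q3 h.q4
  rw [Search.cellOk_eq] at hok
  have := Search.le_volume_of_search P 50 hok
    (by simp only [Search.Inside]; norm_num; constructor <;> linarith)
    (by simp only [Search.Inside]; norm_num; constructor <;> linarith)
    (by simp only [Search.Inside]; norm_num; constructor <;> linarith)
    (by simp only [Search.Inside]; norm_num; constructor <;> linarith)
  linarith

theorem volume_preimage_frame (K : Set (ℝ × ℝ)) {u w : ℝ × ℝ} (h : cross u w ≠ 0) :
    volume (frame u w ⁻¹' K) = ENNReal.ofReal |(cross u w)⁻¹| * volume K := by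
  rw [Measure.addHaar_preimage_linearMap _ (by rwa [det_frame]), det_frame]

/-- The rectangle is centrally symmetric, so its direction matters only up to sign. -/
theorem Contains.half_turn (h : Contains K X Y c s) : Contains K X Y (-c) (-s) where
  convex := h.convex
  finite := h.finite
  unit := by rw [neg_sq, neg_sq]; exact h.unit
  disc := h.disc
  right := h.right
  left := h.left
  q1 := by convert h.q3 using 2 <;> ring
  q2 := by convert h.q4 using 2 <;> ring
  q3 := by convert h.q1 using 2 <;> ring
  q4 := by convert h.q2 using 2 <;> ring

theorem Contains.reflect (h : Contains K X Y c s) :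
    Contains (frame (1, 0) (0, -1) ⁻¹' K) (X.1, -X.2) (Y.1, -Y.2) c (-s) where
  convex := h.convex.linear_preimage _
  finite := by
    rw [volume_preimage_frame _ (by norm_num [cross])]
    exact ENNReal.mul_ne_top ENNReal.ofReal_ne_top h.finite
  unit := by rw [neg_sq]; exact h.unit
  disc p hp := by
    rw [Set.mem_preimage, frame_apply]
    apply h.disc
    simpa using hp
  right := by rw [Set.mem_preimage, frame_apply]; simpa using h.right
  left := by rw [Set.mem_preimage, frame_apply]; simpa using h.left
  q1 := by rw [Set.mem_preimage, frame_apply]; convert h.q2 using 2 <;> ring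
  q2 := by rw [Set.mem_preimage, frame_apply]; convert h.q1 using 2 <;> ring
  q3 := by rw [Set.mem_preimage, frame_apply]; convert h.q4 using 2 <;> ring
  q4 := by rw [Set.mem_preimage, frame_apply]; convert h.q3 using 2 <;> ring

theorem Contains.neg (h : Contains K X Y c s) :
    Contains (frame (-1, 0) (0, -1) ⁻¹' K) (-X.1, -X.2) (-Y.1, -Y.2) c s where
  convex := h.convex.linear_preimage _
  finite := by
    rw [volume_preimage_frame _ (by norm_num [cross])]
    exact ENNReal.mul_ne_top ENNReal.ofReal_ne_top h.finite
  unit := h.unit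
  disc p hp := by
    rw [Set.mem_preimage, frame_apply]
    apply h.disc
    simpa using hp
  right := by rw [Set.mem_preimage, frame_apply]; convert h.left using 2 <;> ring
  left := by rw [Set.mem_preimage, frame_apply]; convert h.right using 2 <;> ring
  q1 := by rw [Set.mem_preimage, frame_apply]; convert h.q3 using 2 <;> ring
  q2 := by rw [Set.mem_preimage, frame_apply]; convert h.q4 using 2 <;> ring
  q3 := by rw [Set.mem_preimage, frame_apply]; convert h.q1 using 2 <;> ring
  q4 := by rw [Set.mem_preimage, frame_apply]; convert h.q2 using 2 <;> ring

/-- A half turn of the rectangle about its own centre makes `c` nonnegative, a reflection in the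
horizontal axis then makes `s` nonnegative, and a central symmetry of the whole figure makes `X.1`
nonnegative without changing the direction. -/
theorem Contains.le_volume (h : Contains K X Y c s) : 1048576000000000 ≤ volume.real K := by
  have pos_X : ∀ {K : Set (ℝ × ℝ)} {X Y : ℝ × ℝ} {c s : ℝ}, Contains K X Y c s → 0 ≤ c → 0 ≤ s →
      1048576000000000 ≤ volume.real K := by
    intro K X Y c s h hc hs
    rcases le_total 0 X.1 with hX | hX
    · exact h.le_volume_of_nonneg hc hs hX
    · have := h.neg.le_volume_of_nonneg hc hs (by simpa using hX)
      rw [measureReal_def, volume_preimage_frame _ (by norm_num [cross])] at this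
      simpa [cross, measureReal_def] using this
  have pos_s : ∀ {K : Set (ℝ × ℝ)} {X Y : ℝ × ℝ} {c s : ℝ}, Contains K X Y c s → 0 ≤ c →
      1048576000000000 ≤ volume.real K := by
    intro K X Y c s h hc
    rcases le_total 0 s with hs | hs
    · exact pos_X h hc hs
    · have := pos_X h.reflect hc (by simpa using hs)
      rw [measureReal_def, volume_preimage_frame _ (by norm_num [cross])] at this
      simpa [cross, measureReal_def] using this
  rcases le_total 0 c with hc | hc
  · exact pos_s h hc
  · exact pos_s h.half_turn (by simpa using hc)

/-! ### Transfer to the Euclidean plane. -/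

/-- The plane in coordinates. -/
def toPlane (p : ℝ × ℝ) : Plane := !₂[p.1, p.2]

theorem measurePreserving_toPlane_preimage (S : Set Plane) :
    volume (toPlane ⁻¹' S) = volume S := by
  have h := (PiLp.volume_preserving_toLp (Fin 2)).comp
    ((volume_preserving_finTwoArrow ℝ).symm MeasurableEquiv.finTwoArrow)
  let e := (MeasurableEquiv.finTwoArrow (α := ℝ)).symm.trans (MeasurableEquiv.toLp 2 (Fin 2 → ℝ))
  have he : MeasurePreserving e volume volume := h
  have := he.measure_preimage_equiv S
  rw [← this]
  rfl

theorem one_div_two_pi_gt : 16297460 / 102400000 < 1 / (2 * Real.pi) := by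
  have := Real.pi_lt_d6
  have := Real.pi_pos
  rw [div_lt_div_iff₀ (by norm_num) (by positivity)]
  linarith

/-- Every point of the disc lies on a horizontal chord whose ends are on the circle. The chord at
the top or bottom degenerates to a point, the case `w = 0`. -/
theorem toPlane_mem_of_circle {S : Set Plane} (hS : Convex ℝ S) {θ : ℝ} {t : Plane}
    (h : motion θ t '' circleOfPerimeter 1 ⊆ S) {a b : ℝ}
    (hab : a ^ 2 + b ^ 2 ≤ (1 / (2 * Real.pi)) ^ 2) : toPlane (a + t 0, b + t 1) ∈ S := by
  set r := 1 / (2 * Real.pi)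
  have hr : 0 < r := by have := Real.pi_pos; positivity
  have hcs := Real.cos_sq_add_sin_sq θ
  have circle : ∀ x y : ℝ, x ^ 2 + y ^ 2 = r ^ 2 → toPlane (x + t 0, y + t 1) ∈ S := by
    intro x y hxy
    apply h
    refine ⟨!₂[Real.cos θ * x + Real.sin θ * y, -Real.sin θ * x + Real.cos θ * y], ?_, ?_⟩
    · rw [circleOfPerimeter, mem_sphere_zero_iff_norm, EuclideanSpace.norm_eq, Real.sqrt_eq_iff_eq_sq
        (by positivity) hr.le]
      simp only [Fin.sum_univ_two, Real.norm_eq_abs, sq_abs]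
      simp
      rw [← hxy]
      linear_combination (x ^ 2 + y ^ 2) * hcs
    · ext i
      fin_cases i <;> simp [motion, toPlane]
      · linear_combination x * hcs
      · linear_combination y * hcs
  set w := √(r ^ 2 - b ^ 2)
  have hw2 : w ^ 2 = r ^ 2 - b ^ 2 := Real.sq_sqrt (by nlinarith [sq_nonneg a])
  have hw0 : 0 ≤ w := Real.sqrt_nonneg _
  have haw : |a| ≤ w := Real.abs_le_sqrt (by linarith)
  obtain ⟨h1, h2⟩ := abs_le.1 haw
  have m1 := circle w b (by linarith)
  have m2 := circle (-w) b (by rw [neg_sq]; linarith)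
  rcases hw0.eq_or_lt with h0 | h0
  · have : a = w := by linarith
    rwa [this]
  · have := hS m1 m2 (a := (w + a) / (2 * w)) (b := (w - a) / (2 * w))
      (div_nonneg (by linarith) (by linarith)) (div_nonneg (by linarith) (by linarith))
      (by field_simp; ring)
    convert this using 1
    ext i
    fin_cases i <;> simp [toPlane] <;> field_simp <;> ring

theorem le_volume_of_copies {S : Set Plane} (hS : Convex ℝ S) {θ₁ θ₂ θ₃ : ℝ} {t₁ t₂ t₃ : Plane}
    (h₁ : motion θ₁ t₁ '' circleOfPerimeter 1 ⊆ S)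
    (h₂ : motion θ₂ t₂ '' segmentOfLength (1 / 2) ⊆ S)
    (h₃ : motion θ₃ t₃ '' rectangle 0.1727 0.3273 ⊆ S) : ENNReal.ofReal 0.1 ≤ volume S := by
  by_cases hfin : volume S = ⊤
  · rw [hfin]; exact le_top
  set c := Real.cos θ₂
  set s := Real.sin θ₂
  have hcs : c ^ 2 + s ^ 2 = 1 := Real.cos_sq_add_sin_sq θ₂
  have hcs₃ := Real.cos_sq_add_sin_sq θ₃
  set k : ℝ := 102400000
  set f := frame (c / k, s / k) (-s / k, c / k)
  set o : ℝ × ℝ := (t₁ 0, t₁ 1)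
  set K : Set (ℝ × ℝ) := f ⁻¹' ((fun p => p + o) ⁻¹' (toPlane ⁻¹' S))
  -- `f` is the rotation by `θ₂` scaled by `1 / k`, so pulling back along it multiplies areas by `k
  -- ^ 2`.
  have hdet : cross (c / k, s / k) (-s / k, c / k) = 1 / k ^ 2 := by
    rw [← hcs]; simp only [cross]; ring
  have hvol : volume K = ENNReal.ofReal (k ^ 2) * volume S := by
    rw [volume_preimage_frame _ (by rw [hdet]; norm_num [k]), hdet, measure_preimage_add_right,
      measurePreserving_toPlane_preimage]
    congr 2
    rw [one_div, inv_inv, abs_of_nonneg (by positivity)]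
  have hmem : ∀ x y a b : ℝ, c * x - s * y = k * (a - t₁ 0) → s * x + c * y = k * (b - t₁ 1) →
      toPlane (a, b) ∈ S → (x, y) ∈ K := by
    intro x y a b h1 h2 h
    have e : f (x, y) + o = (a, b) := by
      simp only [f, frame_apply, o, k] at h1 h2 ⊢
      ext <;> simp only [Prod.fst_add, Prod.snd_add]
      · linear_combination h1 / 102400000
      · linear_combination h2 / 102400000
    simp only [K, Set.mem_preimage]
    rwa [e]
  have hconv : Convex ℝ K := by
    have h1 : Convex ℝ (toPlane ⁻¹' S) := by
      intro x hx y hy a b ha hb hab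
      have := hS hx hy ha hb hab
      rw [Set.mem_preimage]
      convert this using 1
      ext i
      fin_cases i <;> simp [toPlane]
    exact (h1.translate_preimage_left o).linear_preimage f
  have hseg : ∀ e : ℝ, |e| ≤ 1 / 4 → toPlane (c * e + t₂ 0, s * e + t₂ 1) ∈ S := by
    intro e he
    obtain ⟨e1, e2⟩ := abs_le.1 he
    apply h₂
    refine ⟨!₂[e, 0], ?_, ?_⟩
    · refine ⟨1 / 2 - 2 * e, 1 / 2 + 2 * e, by linarith, by linarith, by ring, ?_⟩
      ext i
      fin_cases i <;> simp
      ring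
    · ext i
      fin_cases i <;> simp [motion, toPlane, c, s]
  have hrect : ∀ x y : ℝ, |x| ≤ 0.08635 → |y| ≤ 0.16365 → toPlane
      (Real.cos θ₃ * x - Real.sin θ₃ * y + t₃ 0, Real.sin θ₃ * x + Real.cos θ₃ * y + t₃ 1) ∈ S := by
    intro x y hx hy
    apply h₃
    refine ⟨!₂[x, y], ⟨?_, ?_⟩, ?_⟩
    · simp; norm_num at hx ⊢; exact hx
    · simp; norm_num at hy ⊢; exact hy
    · ext i
      fin_cases i <;> simp [motion, toPlane]
  set c₃ := Real.cos θ₃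
  set s₃ := Real.sin θ₃
  -- The longer side of the model rectangle is vertical, so its direction relative to the segment is
  -- `θ₃ - θ₂` plus a quarter turn; hence minus the sine, then the cosine, of `θ₃ - θ₂`.
  have main : Contains K
      (k * (c * (t₂ 0 - t₁ 0) + s * (t₂ 1 - t₁ 1)), k * (-s * (t₂ 0 - t₁ 0) + c * (t₂ 1 - t₁ 1)))
      (k * (c * (t₃ 0 - t₁ 0) + s * (t₃ 1 - t₁ 1)), k * (-s * (t₃ 0 - t₁ 0) + c * (t₃ 1 - t₁ 1)))
      (-(s₃ * c - c₃ * s)) (c₃ * c + s₃ * s) := by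
    have a1 : |(0.08635 : ℝ)| ≤ 0.08635 := by norm_num [abs_le]
    have a2 : |(-0.08635 : ℝ)| ≤ 0.08635 := by norm_num [abs_le]
    have b1 : |(0.16365 : ℝ)| ≤ 0.16365 := by norm_num [abs_le]
    have b2 : |(-0.16365 : ℝ)| ≤ 0.16365 := by norm_num [abs_le]
    refine ⟨hconv, ?_, ?_, ?_, ?_, ?_, ?_, ?_, ?_, ?_⟩
    · rw [hvol]; exact ENNReal.mul_ne_top ENNReal.ofReal_ne_top hfin
    · linear_combination (c₃ ^ 2 + s₃ ^ 2) * hcs + hcs₃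
    · intro p hp
      refine hmem p.1 p.2 ((c * p.1 - s * p.2) / k + t₁ 0) ((s * p.1 + c * p.2) / k + t₁ 1)
        (by simp only [k]; ring) (by simp only [k]; ring) (toPlane_mem_of_circle hS h₁ ?_)
      have e : ((c * p.1 - s * p.2) / k) ^ 2 + ((s * p.1 + c * p.2) / k) ^ 2
          = (p.1 ^ 2 + p.2 ^ 2) / k ^ 2 := by
        linear_combination (p.1 ^ 2 + p.2 ^ 2) / k ^ 2 * hcs
      rw [e]
      calc (p.1 ^ 2 + p.2 ^ 2) / k ^ 2 ≤ 265607202451600 / k ^ 2 := by gcongr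
        _ = (16297460 / 102400000) ^ 2 := by norm_num [k]
        _ ≤ _ := pow_le_pow_left₀ (by norm_num) one_div_two_pi_gt.le 2
    · refine hmem _ _ _ _ ?_ ?_ (hseg (1 / 4) (by norm_num [abs_le]))
      · linear_combination k * (t₂ 0 - t₁ 0) * hcs
      · linear_combination k * (t₂ 1 - t₁ 1) * hcs
    · refine hmem _ _ _ _ ?_ ?_ (hseg (-(1 / 4)) (by norm_num [abs_le]))
      · linear_combination k * (t₂ 0 - t₁ 0) * hcs
      · linear_combination k * (t₂ 1 - t₁ 1) * hcs
    · refine hmem _ _ _ _ ?_ ?_ (hrect (-0.08635) 0.16365 a2 b1)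
      · linear_combination (k * (t₃ 0 - t₁ 0) + 16757760 * (-s₃) - 8842240 * c₃) * hcs
      · linear_combination (k * (t₃ 1 - t₁ 1) + 16757760 * c₃ - 8842240 * s₃) * hcs
    · refine hmem _ _ _ _ ?_ ?_ (hrect 0.08635 0.16365 a1 b1)
      · linear_combination (k * (t₃ 0 - t₁ 0) + 16757760 * (-s₃) + 8842240 * c₃) * hcs
      · linear_combination (k * (t₃ 1 - t₁ 1) + 16757760 * c₃ + 8842240 * s₃) * hcs
    · refine hmem _ _ _ _ ?_ ?_ (hrect 0.08635 (-0.16365) a1 b2)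
      · linear_combination (k * (t₃ 0 - t₁ 0) - 16757760 * (-s₃) + 8842240 * c₃) * hcs
      · linear_combination (k * (t₃ 1 - t₁ 1) - 16757760 * c₃ + 8842240 * s₃) * hcs
    · refine hmem _ _ _ _ ?_ ?_ (hrect (-0.08635) (-0.16365) a2 b2)
      · linear_combination (k * (t₃ 0 - t₁ 0) - 16757760 * (-s₃) - 8842240 * c₃) * hcs
      · linear_combination (k * (t₃ 1 - t₁ 1) - 16757760 * c₃ - 8842240 * s₃) * hcs
  have h := main.le_volume
  rw [measureReal_def, hvol, ENNReal.toReal_mul, ENNReal.toReal_ofReal (by positivity)] at h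
  rw [ENNReal.ofReal_le_iff_le_toReal hfin]
  norm_num [k] at h ⊢
  linarith

end ConvexCover

end

theorem theorem1 :
    (∀ C L R : Set ConvexCover.Plane,
      ConvexCover.IsCopy (ConvexCover.circleOfPerimeter 1) C →
      ConvexCover.IsCopy (ConvexCover.segmentOfLength (1 / 2)) L →
      ConvexCover.IsCopy (ConvexCover.rectangle 0.1727 0.3273) R →
      ENNReal.ofReal 0.1 ≤ volume (convexHull ℝ (C ∪ L ∪ R))) ∧
    (∀ S : Set ConvexCover.Plane,
      ConvexCover.IsConvexCover
        {ConvexCover.circleOfPerimeter 1, ConvexCover.segmentOfLength (1 / 2),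
          ConvexCover.rectangle 0.1727 0.3273} S →
      ENNReal.ofReal 0.1 ≤ volume S) := by
  constructor
  · rintro C L R ⟨θ₁, t₁, rfl⟩ ⟨θ₂, t₂, rfl⟩ ⟨θ₃, t₃, rfl⟩
    have h := subset_convexHull ℝ (ConvexCover.motion θ₁ t₁ '' ConvexCover.circleOfPerimeter 1 ∪
      ConvexCover.motion θ₂ t₂ '' ConvexCover.segmentOfLength (1 / 2) ∪
      ConvexCover.motion θ₃ t₃ '' ConvexCover.rectangle 0.1727 0.3273)
    exact ConvexCover.le_volume_of_copies (convex_convexHull ℝ _)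
      (fun x hx => h (Or.inl (Or.inl hx))) (fun x hx => h (Or.inl (Or.inr hx)))
      (fun x hx => h (Or.inr hx))
  · rintro S ⟨hS, h⟩
    obtain ⟨_, ⟨θ₁, t₁, rfl⟩, h₁⟩ := h (ConvexCover.circleOfPerimeter 1) (by simp)
    obtain ⟨_, ⟨θ₂, t₂, rfl⟩, h₂⟩ := h (ConvexCover.segmentOfLength (1 / 2)) (by simp)
    obtain ⟨_, ⟨θ₃, t₃, rfl⟩, h₃⟩ := h (ConvexCover.rectangle 0.1727 0.3273) (by simp)
    exact ConvexCover.le_volume_of_copies hS h₁ h₂ h₃
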